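/- Let $n\ge 1$, let $V=\mathbb{R}^n$ with dual space $V^*$ (identified with $\mathbb{R}^n$ by the dot product), and let $W=V\times V^*$ with its natural volume. A symmetric convex body is a compact convex set $K\subset V$ with non-empty interior and $K=-K$; let $K^\circ=\{y\in V^*\mid \langle K,y\rangle\subseteq[-1,1]\}$ be its polar body, and put $$K^\pm=\{(x,y)\in K\times K^\circ\mid \langle x,y\rangle=\pm1\},\qquad K^\diamond=\operatorname{conv}(K^+\cup K^-).$$ Let $J_K\subset W$ be the union of all line segments joining a point of $K^+$ to a point of $K^-$, and let $K^\heartsuit$ be the closed region enclosed by $J_K$, i.e. the union of $J_K$ and the bounded connected components of $W\setminus J_K$. Give $W$ the symmetric bilinear form $\langle (x,y),(x',y')\rangle=\langle x,y'\rangle+\langle x',y\rangle$, extend it to $\bigwedge^n W$ by $\langle v_1\wedge\cdots\wedge v_n,\,w_1\wedge\cdots\wedge w_n\rangle=\det(\langle v_i,w_j\rangle)$, and call $Q(\omega)=\langle\omega,\omega\rangle$ the energy of $\omega\in\bigwedge^nW$. Let $B\subset\mathbb{R}^n$ be the closed unit ball. A disk bounded by $K^+$ is a map $f:B\to W$ that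 is Lipschitz on $B$ and restricts to a bi-Lipschitz bijection from $\partial B$ onto $K^+$ (for example, a smooth embedding of $B$ with $f(\partial B)=K^+$). A directed volume $\operatorname{\overrightarrow{vol}}K^+$ enclosed by $K^+$ is any value $$\int_B \frac{\partial f}{\partial x_1}\wedge\cdots\wedge\frac{\partial f}{\partial x_n}\,dx\in\textstyle\bigwedge^nW$$ of the integral over such a disk. Then for every symmetric convex body $K\subset V$: 1. the directed volume $\operatorname{\overrightarrow{vol}}K^+$ exists and is unique up to sign (the choice of an orientation), and $$\binom{2n}{n}\operatorname{Vol}K^\heartsuit=Q(\operatorname{\overrightarrow{vol}}K^+);$$ 2. $K^\heartsuit\subseteq K^\diamond$; 3. $K^\heartsuit=K^\diamond$ if $K$ is an ellipsoid centered at the origin. Consequently the energy conjecture in dimension $n$ implies the bottleneck conjecture in dimension $n$. Here the energy conjecture says that, for all ellipsoids $E$ centered at the origin and all symmetric convex bodies $K$ in $\mathbb{R}^n$, $Q(\operatorname{\overrightarrow{vol}}E^+)\le Q(\operatorname{\overrightarrow{vol}}K^+)$, with equality if and only if $K$ is an ellipsoid; the bottleneck conjecture says that for all such $E$ and $K$,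 $\operatorname{Vol}E^\diamond\le\operatorname{Vol}K^\diamond$, with equality if and only if $K$ is an ellipsoid. The same implication holds if in both conjectures $K$ ranges only over the symmetric convex bodies in a given class $\mathcal{C}$ (for example, those for which $K$ and $K^\circ$ are smooth). -/

import Mathlib

open MeasureTheory Set Metric

/-- The space `V = ℝⁿ`. The dual space `V*` is identified with `ℝⁿ` through the dot product. -/
abbrev VSpace (n : ℕ) : Type := EuclideanSpace ℝ (Fin n)

/-- The space `W = V × V*`, with its natural (product Lebesgue) volume. -/
abbrev WSpace (n : ℕ) : Type := VSpace n × VSpace n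

/-- Convex bodies (compact, convex, with interior points) that are centrally symmetric about the
origin. -/
structure IsSymmetricConvexBody {n : ℕ} (K : Set (VSpace n)) : Prop where
  isCompact : IsCompact K
  convex : Convex ℝ K
  nonempty_interior : (interior K).Nonempty
  neg_mem : ∀ x ∈ K, -x ∈ K

/-- Ellipsoids centered at the origin: images of the round unit ball under linear isomorphisms. -/
def IsEllipsoid {n : ℕ} (K : Set (VSpace n)) : Prop :=
  ∃ A : VSpace n ≃ₗ[ℝ] VSpace n, K = A '' closedBall 0 1

/-- The polar body `K° = {y ∈ V* | ⟨K, y⟩ ⊆ [-1, 1]}`. -/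
def polarBody {n : ℕ} (K : Set (VSpace n)) : Set (VSpace n) :=
  {y | ∀ x ∈ K, inner ℝ x y ∈ Icc (-1 : ℝ) 1}

/-- `K⁺ = {(x, y) ∈ K × K° | ⟨x, y⟩ = 1}`. -/
def kPlus {n : ℕ} (K : Set (VSpace n)) : Set (WSpace n) :=
  {w | w.1 ∈ K ∧ w.2 ∈ polarBody K ∧ inner ℝ w.1 w.2 = (1 : ℝ)}

/-- `K⁻ = {(x, y) ∈ K × K° | ⟨x, y⟩ = -1}`. -/
def kMinus {n : ℕ} (K : Set (VSpace n)) : Set (WSpace n) :=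
  {w | w.1 ∈ K ∧ w.2 ∈ polarBody K ∧ inner ℝ w.1 w.2 = (-1 : ℝ)}

/-- `K^◇`, the convex hull of `K⁺ ∪ K⁻`. -/
def kDiamond {n : ℕ} (K : Set (VSpace n)) : Set (WSpace n) :=
  convexHull ℝ (kPlus K ∪ kMinus K)

/-- The closed region of `W` enclosed by a set `S`: the points of `S` together with the points
whose connected component in the complement of `S` is bounded. -/
def enclosedRegion {n : ℕ} (S : Set (WSpace n)) : Set (WSpace n) :=
  S ∪ {w | w ∉ S ∧ Bornology.IsBounded (connectedComponentIn Sᶜ w)}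

/-- `K^♥`, the region of `W` enclosed by the union of all line segments that connect a point of
`K⁺` to a point of `K⁻`. -/
def kHeart {n : ℕ} (K : Set (VSpace n)) : Set (WSpace n) :=
  enclosedRegion (convexJoin ℝ (kPlus K) (kMinus K))

/-- The symmetric bilinear form on `W = V × V*` that extends the pairing of `V` and `V*` and
vanishes on `V × V` and on `V* × V*`, as a map from `W` to its dual:
`⟨(x, y), (x', y')⟩ = ⟨x, y'⟩ + ⟨x', y⟩`. -/
noncomputable def pairingForm (n : ℕ) : WSpace n →ₗ[ℝ] Module.Dual ℝ (WSpace n) :=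
  LinearMap.mk₂ ℝ (fun v w : WSpace n => inner ℝ v.1 w.2 + inner ℝ w.1 v.2)
    (fun _ _ _ => by simp only [Prod.fst_add, Prod.snd_add, inner_add_left, inner_add_right]; ring)
    (fun _ _ _ => by
      simp only [Prod.smul_fst, Prod.smul_snd, real_inner_smul_left, real_inner_smul_right,
        smul_eq_mul]; ring)
    (fun _ _ _ => by simp only [Prod.fst_add, Prod.snd_add, inner_add_left, inner_add_right]; ring)
    (fun _ _ _ => by
      simp only [Prod.smul_fst, Prod.smul_snd, real_inner_smul_left, real_inner_smul_right,
        smul_eq_mul]; ring)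

/-- The induced symmetric bilinear form on `k`-tensors, `⟨v₁ ∧ ⋯ ∧ vₖ, w₁ ∧ ⋯ ∧ wₖ⟩ =
det (⟨vᵢ, wⱼ⟩)` (see `exteriorForm_ιMulti`). -/
noncomputable def exteriorForm (n k : ℕ) (ω ν : ⋀[ℝ]^k (WSpace n)) : ℝ :=
  exteriorPower.pairingDual ℝ (WSpace n) k (exteriorPower.map k (pairingForm n) ω) ν

/-- The energy `Q(ω) = ⟨ω, ω⟩` of a `k`-tensor. -/
noncomputable def energy {n k : ℕ} (ω : ⋀[ℝ]^k (WSpace n)) : ℝ :=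
  exteriorForm n k ω ω

theorem exteriorForm_ιMulti (n k : ℕ) (v w : Fin k → WSpace n) :
    exteriorForm n k (exteriorPower.ιMulti ℝ k v) (exteriorPower.ιMulti ℝ k w) =
      Matrix.det (Matrix.of fun i j =>
        (inner ℝ (v i).1 (w j).2 + inner ℝ (w j).1 (v i).2 : ℝ)) := by
  rw [← Matrix.det_transpose]
  simp only [exteriorForm, exteriorPower.map_apply_ιMulti, exteriorPower.pairingDual_ιMulti_ιMulti]
  rfl

/-- `ω` is the directed volume `∫ ∂f/∂x₁ ∧ ⋯ ∧ ∂f/∂xₖ dx` over the closed unit ball of `ℝᵏ` of the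
map `f`. The integral of a function with values in the finite-dimensional space `⋀ᵏ W` is
characterized by its values under all linear functionals. -/
def IsDirectedVolume {n k : ℕ} (f : VSpace k → WSpace n) (ω : ⋀[ℝ]^k (WSpace n)) : Prop :=
  ∀ l : Module.Dual ℝ (⋀[ℝ]^k (WSpace n)),
    l ω = ∫ x in closedBall (0 : VSpace k) 1,
      l (exteriorPower.ιMulti ℝ k fun i => fderiv ℝ f x (EuclideanSpace.single i 1))

/-- `f` parametrizes, by the closed unit ball of `ℝᵏ`, a Lipschitz `k`-dimensional disk in `W` with
boundary `N`: `f` is Lipschitz on the closed ball, and restricts to a bi-Lipschitz parametrization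
of `N` by the unit sphere. In particular, `f` can be a smooth embedding of the closed ball. -/
structure IsDiskFilling {n k : ℕ} (N : Set (WSpace n)) (f : VSpace k → WSpace n) : Prop where
  lipschitz : ∃ C : NNReal, LipschitzOnWith C f (closedBall 0 1)
  boundary : f '' sphere 0 1 = N
  bilipschitz : ∃ c : ℝ, 0 < c ∧
    ∀ x ∈ sphere (0 : VSpace k) 1, ∀ y ∈ sphere (0 : VSpace k) 1, c * dist x y ≤ dist (f x) (f y)

/-- `ω` is the directed volume enclosed by the `(k-1)`-sphere `N`, for one of its two orientations:
the directed volume of a `k`-dimensional disk with boundary `N`. -/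
def IsEnclosedDirectedVolume {n k : ℕ} (N : Set (WSpace n)) (ω : ⋀[ℝ]^k (WSpace n)) : Prop :=
  ∃ f : VSpace k → WSpace n, IsDiskFilling N f ∧ IsDirectedVolume f ω

/-- Among the symmetric convex bodies `K` in the class `𝒞`, the energy of the directed volume
enclosed by `K⁺` is uniquely minimized when `K` is an ellipsoid. -/
def EnergyConjectureOn {n : ℕ} (𝒞 : Set (Set (VSpace n))) : Prop :=
  ∀ E K : Set (VSpace n), IsEllipsoid E → IsSymmetricConvexBody K → K ∈ 𝒞 →
    ∀ ωE ωK : ⋀[ℝ]^n (WSpace n),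
      IsEnclosedDirectedVolume (kPlus E) ωE → IsEnclosedDirectedVolume (kPlus K) ωK →
        energy ωE ≤ energy ωK ∧ (energy ωK = energy ωE ↔ IsEllipsoid K)

/-- Among the symmetric convex bodies `K` in the class `𝒞`, the volume of `K^◇` is uniquely
minimized when `K` is an ellipsoid. -/
def BottleneckConjectureOn {n : ℕ} (𝒞 : Set (Set (VSpace n))) : Prop :=
  ∀ E K : Set (VSpace n), IsEllipsoid E → IsSymmetricConvexBody K → K ∈ 𝒞 →
    volume.real (kDiamond E) ≤ volume.real (kDiamond K) ∧
      (volume.real (kDiamond K) = volume.real (kDiamond E) ↔ IsEllipsoid K)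

/-- The energy conjecture in dimension `n`, for all symmetric convex bodies. -/
def EnergyConjecture (n : ℕ) : Prop :=
  EnergyConjectureOn (univ : Set (Set (VSpace n)))

/-- The bottleneck conjecture in dimension `n`, for all symmetric convex bodies. -/
def BottleneckConjecture (n : ℕ) : Prop :=
  BottleneckConjectureOn (univ : Set (Set (VSpace n)))

/-! The proof puts global coordinates on the cone over `K⁺`. Minimizing `gauge K p ^ 2 + ‖z - p‖ ^
2` over `p` gives the Moreau decomposition `z = p z + q z`, where `q z` is a subgradient at `p z` of
half the squared gauge. With `s z = gauge K (p z)`, the pairs `(p z, q z)` with `s z = 1` form `K⁺`,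
and all the pairs form the cone over it. Monotonicity, in the sharp form `sq_level_sub_le`, makes
`p`, `q`, `s` and the reflection `p - q` 1-Lipschitz. Moreover `p` is a gradient, so its derivatives
are symmetric.

A point of the cone over `K⁺` plus a point of the cone over `K⁻` is `(p z + p z', q z - q z')`. In
the coordinates `x + y`, `x - y` of `W` this map is the identity plus a 1-Lipschitz map `G` built
from two swapped reflections (`joinMap_eq`). It is surjective and determines `s z + s z'`. This sum
descends to a homogeneous function `N` on `W`, whose unit level is the join and whose unit sublevel
is the heart.

For the volume, `(2n)! Vol {N ≤ 1} = ∫ exp (-N)`. The maps `id + tG` with `t < 1` are bijections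
with positive Jacobian, and `t → 1` gives the change of variables at `t = 1` without injectivity.
The Jacobian is `2 ^ n` times the pairing of the tangent `n`-vectors of the cone at `z` and `z'`
(`det_id_add_fderiv_crossReflection`). So the integral splits by Fubini into `n! ^ 2 * energy ω`,
with `ω` the directed volume of the cone truncated at `s = 1`.

An arbitrary disk bounded by `K⁺` has directed volume `±ω`. The integral of a constant form over a
Lipschitz disk depends only on the boundary values, and a bi-Lipschitz bijection has a Jacobian of
constant sign. Both facts are derived from change of variables for small Lipschitz perturbations of
the identity.

The heart is star-shaped about `0`, hence lies in the convex hull. For an ellipsoid `N` is an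
explicit norm, so the heart is already convex. The conjectures are then linked by `Vol E^◇ = Vol E^♥
≤ Vol K^♥ ≤ Vol K^◇`. -/

set_option linter.unusedSectionVars false

/-! ### Change of variables and the Jacobian integral for Lipschitz maps -/

section LipschitzChangeOfVariables

variable {E F : Type*} [NormedAddCommGroup E] [NormedSpace ℝ E] [FiniteDimensional ℝ E]
  [MeasurableSpace E] [BorelSpace E] [NormedAddCommGroup F] [NormedSpace ℝ F]
  (μ : Measure E) [μ.IsAddHaarMeasure]

theorem LipschitzWith.addHaar_image_eq_zero {f : E → E} {C : NNReal} (hf : LipschitzWith C f)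
    {s : Set E} (hs : μ s = 0) : μ (f '' s) = 0 := by
  have h1 : (Measure.hausdorffMeasure (Module.finrank ℝ E) : Measure E) s = 0 :=
    Measure.absolutelyContinuous_isAddHaarMeasure _ μ hs
  refine Measure.absolutelyContinuous_isAddHaarMeasure μ
    (Measure.hausdorffMeasure (Module.finrank ℝ E)) ?_
  refine le_antisymm ((hf.hausdorffMeasure_image_le (Nat.cast_nonneg _) s).trans ?_) bot_le
  simp [h1]

/-- By Rademacher the bad points form a null set, and their image is null too. This carries the
change of variables formula from differentiable to Lipschitz maps. -/
theorem LipschitzWith.inter_differentiableAt_ae_eq {f : E → E} {C : NNReal}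
    (hf : LipschitzWith C f) (s : Set E) :
    (s ∩ {x | DifferentiableAt ℝ f x} : Set E) =ᵐ[μ] s ∧
      (f '' (s ∩ {x | DifferentiableAt ℝ f x}) : Set E) =ᵐ[μ] f '' s := by
  have hDc : μ {x | DifferentiableAt ℝ f x}ᶜ = 0 := hf.ae_differentiableAt (μ := μ)
  refine ⟨inter_ae_eq_left_of_ae_eq_univ (by rwa [ae_eq_univ]), ?_⟩
  refine (image_mono inter_subset_left).eventuallyLE.antisymm ?_
  rw [ae_le_set]
  refine measure_mono_null ?_ (hf.addHaar_image_eq_zero μ hDc)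
  rintro _ ⟨⟨x, hx, rfl⟩, h⟩
  exact ⟨x, fun hd => h ⟨x, ⟨hx, hd⟩, rfl⟩, rfl⟩

/-- Change of variables for injective Lipschitz maps. -/
theorem LipschitzWith.setIntegral_image {f : E → E} {C : NNReal} (hf : LipschitzWith C f)
    (hinj : Function.Injective f) {s : Set E} (hs : MeasurableSet s) (g : E → F) :
    ∫ y in f '' s, g y ∂μ = ∫ x in s, |(fderiv ℝ f x).det| • g (f x) ∂μ := by
  obtain ⟨h1, h2⟩ := hf.inter_differentiableAt_ae_eq μ s
  rw [← setIntegral_congr_set h1, ← setIntegral_congr_set h2]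
  exact integral_image_eq_integral_abs_det_fderiv_smul μ
    (hs.inter (measurableSet_of_differentiableAt ℝ f))
    (fun x hx => hx.2.hasFDerivAt.hasFDerivWithinAt) hinj.injOn g

theorem LipschitzWith.integral_comp_bijective {f : E → E} {C : NNReal} (hf : LipschitzWith C f)
    (hbij : Function.Bijective f) (g : E → F) :
    ∫ y, g y ∂μ = ∫ x, |(fderiv ℝ f x).det| • g (f x) ∂μ := by
  simpa [image_univ, hbij.surjective.range_eq] using
    hf.setIntegral_image μ hbij.injective MeasurableSet.univ g

theorem LipschitzWith.ae_comp_of_leftInverse {f g : E → E} {C : NNReal} (hg : LipschitzWith C g)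
    (h : Function.LeftInverse g f) {p : E → Prop} (hp : ∀ᵐ y ∂μ, p y) :
    ∀ᵐ x ∂μ, p (f x) := by
  refine measure_mono_null ?_ (hg.addHaar_image_eq_zero μ hp)
  intro x hx
  exact ⟨f x, hx, h x⟩

section
variable [FiniteDimensional ℝ F]

theorem LipschitzWith.exists_bound_comp_fderiv {f : E → F} {C : NNReal} (hf : LipschitzWith C f)
    {φ : (E →L[ℝ] F) → ℝ} (hφ : Continuous φ) : ∃ M, ∀ x, ‖φ (fderiv ℝ f x)‖ ≤ M := by
  obtain ⟨M, hM⟩ := (isCompact_closedBall (0 : E →L[ℝ] F) C).exists_bound_of_continuousOn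
    hφ.continuousOn
  refine ⟨M, fun x => hM _ ?_⟩
  simpa using norm_fderiv_le_of_lipschitz ℝ hf

theorem measurable_comp_fderiv [MeasurableSpace F] [BorelSpace F] (f : E → F)
    {φ : (E →L[ℝ] F) → ℝ} (hφ : Continuous φ) : Measurable fun x => φ (fderiv ℝ f x) :=
  hφ.measurable.comp (measurable_fderiv ℝ f)

theorem LipschitzWith.integrableOn_comp_fderiv [MeasurableSpace F] [BorelSpace F]
    {f : E → F} {C : NNReal} (hf : LipschitzWith C f)
    {φ : (E →L[ℝ] F) → ℝ} (hφ : Continuous φ) {s : Set E} (hs : μ s ≠ ⊤) :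
    IntegrableOn (fun x => φ (fderiv ℝ f x)) s μ := by
  obtain ⟨M, hM⟩ := hf.exists_bound_comp_fderiv hφ
  exact Measure.integrableOn_of_bounded hs
    (measurable_comp_fderiv f hφ).aestronglyMeasurable (ae_of_all _ hM)

end

/-- A preimage of `y` is a fixed point of the contraction `x ↦ y - G x`. -/
theorem bijective_add_of_lipschitz {G : E → E} {k : NNReal} (hG : LipschitzWith k G)
    (hk : k < 1) : Function.Bijective fun x => x + G x := by
  constructor
  · exact (AntilipschitzWith.id.add_lipschitzWith hG (by simpa using hk)).injective
  · intro y
    have hc : ContractingWith k fun x => y - G x :=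
      ⟨hk, by simpa using (LipschitzWith.const y).sub hG⟩
    refine ⟨ContractingWith.fixedPoint _ hc, ?_⟩
    exact (sub_eq_iff_eq_add.1 hc.fixedPoint_isFixedPt).symm

/-- Along `id + t M`, `0 ≤ t ≤ 1`, every map is invertible, so the determinant keeps its sign at `t
= 0`. -/
theorem det_id_add_pos {M : E →L[ℝ] E} (hM : ‖M‖ < 1) :
    0 < (ContinuousLinearMap.id ℝ E + M).det := by
  set d : ℝ → ℝ := fun t => (ContinuousLinearMap.id ℝ E + t • M).det
  have hc : Continuous d := ContinuousLinearMap.continuous_det.comp (by fun_prop)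
  have hne : ∀ t ∈ Icc (0 : ℝ) 1, d t ≠ 0 := by
    intro t ht h0
    have hb := bijective_add_of_lipschitz (G := t • M) (k := ‖t • M‖₊) (t • M).lipschitz (by
      rw [← NNReal.coe_lt_coe, coe_nnnorm, norm_smul, Real.norm_of_nonneg ht.1]
      exact (mul_le_of_le_one_left (norm_nonneg _) ht.2).trans_lt hM)
    have hu := (LinearEquiv.ofBijective
      ((ContinuousLinearMap.id ℝ E + t • M : E →L[ℝ] E) : E →ₗ[ℝ] E) hb).isUnit_det'
    exact hu.ne_zero h0
  have h0 : d 0 = 1 := by simp [d, ContinuousLinearMap.det]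
  have h1 : d 1 = (ContinuousLinearMap.id ℝ E + M).det := by simp [d]
  rw [← h1]
  by_contra hlt
  obtain ⟨t, ht, h⟩ := intermediate_value_Icc' (zero_le_one' ℝ) hc.continuousOn
    (show (0 : ℝ) ∈ Icc (d 1) (d 0) from ⟨not_lt.1 hlt, by simp [h0]⟩)
  exact hne t ht h

theorem LipschitzWith.det_id_add_fderiv_pos {G : E → E} {k : NNReal} (hG : LipschitzWith k G)
    (hk : k < 1) (x : E) : 0 < (ContinuousLinearMap.id ℝ E + fderiv ℝ G x).det :=
  det_id_add_pos ((norm_fderiv_le_of_lipschitz ℝ hG).trans_lt (by exact_mod_cast hk))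

theorem LipschitzWith.id_add {G : E → E} {k : NNReal} (hG : LipschitzWith k G) :
    LipschitzWith (1 + k) fun x => x + G x :=
  LipschitzWith.id.add hG

theorem LipschitzWith.ae_fderiv_id_add {G : E → E} {k : NNReal} (hG : LipschitzWith k G) :
    ∀ᵐ x ∂μ, fderiv ℝ (fun x => x + G x) x = ContinuousLinearMap.id ℝ E + fderiv ℝ G x := by
  filter_upwards [hG.ae_differentiableAt (μ := μ)] with x hx
  exact (hasFDerivAt_id x |>.add hx.hasFDerivAt).fderiv

/-- Change of variables for a contractive perturbation of the identity. -/
theorem LipschitzWith.setIntegral_image_id_add {G : E → E} {k : NNReal} (hG : LipschitzWith k G)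
    (hk : k < 1) {s : Set E} (hs : MeasurableSet s) (h : E → ℝ) :
    ∫ y in (fun x => x + G x) '' s, h y ∂μ =
      ∫ x in s, (ContinuousLinearMap.id ℝ E + fderiv ℝ G x).det * h (x + G x) ∂μ := by
  rw [hG.id_add.setIntegral_image μ (bijective_add_of_lipschitz hG hk).injective hs]
  refine setIntegral_congr_ae hs ?_
  filter_upwards [hG.ae_fderiv_id_add μ] with x hx _
  rw [hx, abs_of_pos (hG.det_id_add_fderiv_pos hk x), smul_eq_mul]

/-- For `r` above the Lipschitz constant, `r id + G` is `r` times an injective map with positive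
Jacobian. The integral of the signed determinant is therefore an honest volume. -/
theorem LipschitzWith.setIntegral_det_smul_id_add_fderiv {G : E → E} {C : NNReal}
    (hG : LipschitzWith C G) {r : ℝ} (hr : (C : ℝ) < r) {s : Set E} (hs : MeasurableSet s) :
    ∫ x in s, (r • ContinuousLinearMap.id ℝ E + fderiv ℝ G x).det ∂μ =
      r ^ Module.finrank ℝ E * μ.real ((fun x => x + r⁻¹ • G x) '' s) := by
  have hr0 : 0 < r := C.coe_nonneg.trans_lt hr
  have hG' : LipschitzWith (‖r⁻¹‖₊ * C) fun x => r⁻¹ • G x := (lipschitzWith_smul r⁻¹).comp hG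
  have hk : ‖r⁻¹‖₊ * C < 1 := by
    rw [← NNReal.coe_lt_coe]
    push_cast
    rw [Real.norm_of_nonneg (inv_nonneg.2 hr0.le), inv_mul_lt_iff₀ hr0]
    simpa using hr
  have h := hG'.setIntegral_image_id_add μ hk hs fun _ => 1
  rw [setIntegral_const, smul_eq_mul, mul_one] at h
  rw [h, ← integral_const_mul]
  refine setIntegral_congr_ae hs ?_
  filter_upwards [hG.ae_differentiableAt (μ := μ)] with x hx _
  have h1 : fderiv ℝ (fun x => r⁻¹ • G x) x = r⁻¹ • fderiv ℝ G x := by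
    exact (hx.hasFDerivAt.const_smul r⁻¹).fderiv
  rw [mul_one, h1]
  have h2 : r • ContinuousLinearMap.id ℝ E + fderiv ℝ G x =
      r • (ContinuousLinearMap.id ℝ E + r⁻¹ • fderiv ℝ G x) := by
    rw [smul_add, smul_smul, mul_inv_cancel₀ hr0.ne', one_smul]
  rw [h2]
  exact LinearMap.det_smul r _

/-- `det (r id + M)` is a polynomial in `r`, the characteristic polynomial of `-M`. Lagrange
interpolation at the nodes `a + j` recovers its value at `r = 0`, with weights independent of `M`.
-/
theorem exists_det_eq_sum_det_smul_id_add (a : ℝ) :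
    ∃ c : ℕ → ℝ, ∀ M : E →L[ℝ] E, M.det = ∑ j ∈ Finset.range (Module.finrank ℝ E + 1),
      c j * ((a + j) • ContinuousLinearMap.id ℝ E + M).det := by
  set s := Finset.range (Module.finrank ℝ E + 1)
  set v : ℕ → ℝ := fun j => a + j
  refine ⟨fun j => (Lagrange.basis s v j).eval 0, fun M => ?_⟩
  have hv : InjOn v s := fun i _ j _ h => by simpa [v] using h
  have key : ∀ r, (LinearMap.charpoly (-(M : E →ₗ[ℝ] E))).eval r =
      (r • ContinuousLinearMap.id ℝ E + M).det := by
    intro r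
    rw [LinearMap.eval_charpoly, sub_neg_eq_add]
    rfl
  have hdeg : (LinearMap.charpoly (-(M : E →ₗ[ℝ] E))).degree < s.card := by
    rw [Polynomial.degree_eq_natDegree (LinearMap.charpoly_monic _).ne_zero,
      LinearMap.charpoly_natDegree]
    simp only [s, Finset.card_range]
    exact_mod_cast Nat.lt_succ_self _
  have h := congrArg (Polynomial.eval 0) (Lagrange.eq_interpolate hv hdeg)
  rw [key, zero_smul, zero_add] at h
  rw [h, Lagrange.interpolate_apply, Polynomial.eval_finsetSum]
  refine Finset.sum_congr rfl fun j _ => ?_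
  rw [Polynomial.eval_mul, Polynomial.eval_C, key, mul_comm]

/-- The integral of the Jacobian determinant of a Lipschitz map over a set of finite measure does
not change when the map is modified inside the set. -/
theorem setIntegral_det_fderiv_congr {G₁ G₂ : E → E} {C₁ C₂ : NNReal} (h₁ : LipschitzWith C₁ G₁)
    (h₂ : LipschitzWith C₂ G₂) {s : Set E} (hs : MeasurableSet s) (hμ : μ s ≠ ⊤)
    (h : EqOn G₁ G₂ sᶜ) :
    ∫ x in s, (fderiv ℝ G₁ x).det ∂μ = ∫ x in s, (fderiv ℝ G₂ x).det ∂μ := by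
  -- With this `a` every node `a + j` exceeds both Lipschitz constants.
  set a : ℝ := C₁ + C₂ + 1
  obtain ⟨c, hc⟩ := exists_det_eq_sum_det_smul_id_add (E := E) a
  have hcont : ∀ r : ℝ, Continuous fun M : E →L[ℝ] E =>
      (r • ContinuousLinearMap.id ℝ E + M).det := fun r =>
    ContinuousLinearMap.continuous_det.comp (by fun_prop)
  have expand : ∀ {G : E → E} {C : NNReal}, LipschitzWith C G →
      ∫ x in s, (fderiv ℝ G x).det ∂μ = ∑ j ∈ Finset.range (Module.finrank ℝ E + 1),
        c j * ∫ x in s, ((a + j) • ContinuousLinearMap.id ℝ E + fderiv ℝ G x).det ∂μ := by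
    intro G C hG
    rw [integral_congr_ae (ae_of_all _ fun x => hc (fderiv ℝ G x)), integral_finsetSum]
    · simp_rw [integral_const_mul]
    · intro j _
      exact (hG.integrableOn_comp_fderiv μ (hcont (a + j)) hμ).const_mul _
  rw [expand h₁, expand h₂]
  refine Finset.sum_congr rfl fun j _ => ?_
  have hj : (0 : ℝ) ≤ j := Nat.cast_nonneg _
  have hC₁ := C₁.coe_nonneg
  have hC₂ := C₂.coe_nonneg
  have hr₁ : (C₁ : ℝ) < a + j := by simp only [a]; linarith
  have hr₂ : (C₂ : ℝ) < a + j := by simp only [a]; linarith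
  rw [h₁.setIntegral_det_smul_id_add_fderiv μ hr₁ hs,
    h₂.setIntegral_det_smul_id_add_fderiv μ hr₂ hs]
  have hbij : ∀ {G : E → E} {C : NNReal}, LipschitzWith C G → (C : ℝ) < a + j →
      Function.Bijective fun x => x + (a + j)⁻¹ • G x := by
    intro G C hG hr
    have hr0 : 0 < a + j := C.coe_nonneg.trans_lt hr
    refine bijective_add_of_lipschitz ((lipschitzWith_smul (a + j)⁻¹).comp hG) ?_
    rw [← NNReal.coe_lt_coe]
    push_cast
    rw [Real.norm_of_nonneg (inv_nonneg.2 hr0.le), inv_mul_lt_iff₀ hr0]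
    simpa using hr
  -- Two bijections that agree off `s` have the same image of `sᶜ`, hence of `s`.
  have himg : (fun x => x + (a + j)⁻¹ • G₁ x) '' s = (fun x => x + (a + j)⁻¹ • G₂ x) '' s := by
    rw [← compl_inj_iff, ← image_compl_eq (hbij h₁ hr₁), ← image_compl_eq (hbij h₂ hr₂)]
    exact image_congr fun x hx => by rw [h hx]
  rw [himg]

end LipschitzChangeOfVariables

/-! ### Constant sign of the Jacobian of a bi-Lipschitz bijection -/

section JacobianSign

variable {E : Type*} [NormedAddCommGroup E] [NormedSpace ℝ E] [FiniteDimensional ℝ E]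
  [MeasurableSpace E] [BorelSpace E] (μ : Measure E) [μ.IsAddHaarMeasure]

/-- The map factors as a transvection, of determinant `1 + ℓ v`, after `M`. -/
theorem det_comp_add_smulRight (M : E →L[ℝ] E) (ℓ : E →L[ℝ] ℝ) (v : E) :
    (M + (ℓ.comp M).smulRight v).det = (1 + ℓ v) * M.det := by
  have h : ((M + (ℓ.comp M).smulRight v : E →L[ℝ] E) : E →ₗ[ℝ] E) =
      (LinearMap.transvection (ℓ : E →ₗ[ℝ] ℝ) v) ∘ₗ (M : E →ₗ[ℝ] E) := by
    ext x
    simp [LinearMap.transvection]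
  rw [ContinuousLinearMap.det, h, LinearMap.det_comp, LinearMap.transvection.det]
  rfl

/-- A bounded measurable function with vanishing weak derivative is constant. -/
theorem exists_ae_eq_const_of_integral_fderiv_eq_zero {θ : E → ℝ} (hθ : Measurable θ)
    {M : ℝ} (hM : ∀ x, ‖θ x‖ ≤ M)
    (h : ∀ ψ : E → ℝ, ContDiff ℝ 1 ψ → HasCompactSupport ψ → ∀ v,
      ∫ y, fderiv ℝ ψ y v * θ y ∂μ = 0) :
    ∃ y₀, ∀ᵐ y ∂μ, θ y = θ y₀ := by
  have hloc : ∀ x, LocallyIntegrable (fun y => θ (y + x)) μ := by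
    intro x
    refine (locallyIntegrable_const M).mono
      (hθ.comp (measurable_add_const x)).aestronglyMeasurable (ae_of_all _ fun y => ?_)
    exact (hM _).trans (le_abs_self M)
  have hloc0 : LocallyIntegrable θ μ := by simpa using hloc 0
  -- Invariance under each translation: the convolution of `θ` with a reflected test function has
  -- zero derivative, so it takes the same value at `x` and at `0`.
  have htrans : ∀ x, ∀ᵐ y ∂μ, θ (y + x) = θ y := by
    intro x
    refine ae_eq_of_integral_contDiff_smul_eq (hloc x) hloc0 fun g hg hgs => ?_
    set φ : E → ℝ := fun y => g (-y)
    have hφ : ContDiff ℝ 1 φ := (hg.of_le (by simp)).comp contDiff_neg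
    have hφs : HasCompactSupport φ := hgs.comp_homeomorph (Homeomorph.neg E)
    have hder : ∀ x₀, HasFDerivAt (convolution θ φ (ContinuousLinearMap.mul ℝ ℝ) μ) (0 : E →L[ℝ] ℝ) x₀ := by
      intro x₀
      have h1 := hφs.hasFDerivAt_convolution_right (ContinuousLinearMap.mul ℝ ℝ) hloc0 hφ x₀
      suffices h5 : convolution θ (fderiv ℝ φ)
          ((ContinuousLinearMap.mul ℝ ℝ).precompR E) μ x₀ = 0 by rwa [h5] at h1
      ext v
      rw [convolution_precompR_apply _ hloc0 (hφs.fderiv ℝ) (hφ.continuous_fderiv one_ne_zero),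
        convolution_def]
      have hψ : ContDiff ℝ 1 fun y => φ (x₀ - y) := hφ.comp (contDiff_const.sub contDiff_id)
      have hψs : HasCompactSupport fun y => φ (x₀ - y) :=
        hφs.comp_homeomorph (Homeomorph.subLeft x₀)
      have h2 : ∀ y, fderiv ℝ (fun y => φ (x₀ - y)) y v = -fderiv ℝ φ (x₀ - y) v := fun y => by
        have h3 := ((hφ.differentiable one_ne_zero (x₀ - y)).hasFDerivAt.comp y
          ((hasFDerivAt_id y).const_sub x₀)).fderiv
        exact (DFunLike.congr_fun h3 v).trans (by simp)
      have h4 := h _ hψ hψs v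
      simp only [h2, neg_mul, integral_neg, neg_eq_zero] at h4
      simpa [mul_comm] using h4
    have hconst := is_const_of_fderiv_eq_zero (𝕜 := ℝ)
      (f := convolution θ φ (ContinuousLinearMap.mul ℝ ℝ) μ) (fun x₀ => (hder x₀).differentiableAt)
      (fun x₀ => (hder x₀).fderiv) x 0
    simp only [convolution_def, ContinuousLinearMap.mul_apply', φ, neg_sub] at hconst
    simp only [smul_eq_mul]
    calc ∫ y, g y * θ (y + x) ∂μ = ∫ y, g (y - x) * θ y ∂μ := by
          rw [← integral_add_right_eq_self (fun y => g (y - x) * θ y) x]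
          simp only [add_sub_cancel_right]
      _ = ∫ y, g y * θ y ∂μ := by simpa [mul_comm] using hconst
  -- Fubini exchanges the quantifiers, so that one base point `y₀` serves almost every `x`.
  have hprod : ∀ᵐ y ∂μ, ∀ᵐ x ∂μ, θ (y + x) = θ y := by
    have hset : MeasurableSet {z : E × E | θ (z.1 + z.2) = θ z.1} :=
      measurableSet_eq_fun (by fun_prop) (by fun_prop)
    refine (Measure.ae_ae_comm (μ := μ) (ν := μ) (p := fun y x => θ (y + x) = θ y) hset).2 ?_
    exact ae_of_all _ htrans
  obtain ⟨y₀, hy₀⟩ := hprod.exists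
  refine ⟨y₀, ?_⟩
  have := (measurePreserving_add_left μ (-y₀)).quasiMeasurePreserving.ae hy₀
  simpa using this

/-- Replacing `H` by `H + ψ(H) v` alters `H` only on a compact set, so the Jacobian integral there
is unchanged. Pointwise the Jacobian is multiplied by `1 + ∂ᵥψ(H)`, and the difference is this
integrand. After a change of variables, the sign of the Jacobian, seen on the target, has zero weak
derivative. -/
theorem integral_fderiv_comp_mul_det_eq_zero {H H' : E → E} {C C' : NNReal}
    (hH : LipschitzWith C H) (hH' : LipschitzWith C' H') (hl : Function.LeftInverse H' H)
    {ψ : E → ℝ} (hψ : ContDiff ℝ 1 ψ)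
    (hψs : HasCompactSupport ψ) (v : E) :
    ∫ x, fderiv ℝ ψ (H x) v * (fderiv ℝ H x).det ∂μ = 0 := by
  set s := H' '' tsupport ψ
  have hs : IsCompact s := hψs.isCompact.image hH'.continuous
  have hout : ∀ x ∉ s, H x ∉ tsupport ψ := fun x hx h => hx ⟨H x, h, hl x⟩
  obtain ⟨D, hD⟩ := hψ.lipschitzWith_of_hasCompactSupport hψs (by simp)
  have hG : LipschitzWith (C + ‖v‖₊ * (D * C)) fun x => H x + ψ (H x) • v := by
    refine hH.add ?_
    refine LipschitzWith.of_dist_le_mul fun x y => ?_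
    rw [dist_eq_norm, ← sub_smul, norm_smul, mul_comm, NNReal.coe_mul, mul_assoc]
    gcongr
    · exact le_rfl
    · exact (hD.comp hH).dist_le_mul x y
  have hcongr := setIntegral_det_fderiv_congr μ hG hH hs.measurableSet hs.measure_ne_top
    (fun x hx => by simp [image_eq_zero_of_notMem_tsupport (hout x hx)])
  have hint : IntegrableOn (fun x => (fderiv ℝ H x).det) s μ :=
    hH.integrableOn_comp_fderiv μ ContinuousLinearMap.continuous_det hs.measure_ne_top
  have hint' := hG.integrableOn_comp_fderiv μ ContinuousLinearMap.continuous_det hs.measure_ne_top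
  have hae : ∀ᵐ x ∂μ, fderiv ℝ ψ (H x) v * (fderiv ℝ H x).det =
      (fderiv ℝ (fun x => H x + ψ (H x) • v) x).det - (fderiv ℝ H x).det := by
    filter_upwards [hH.ae_differentiableAt (μ := μ)] with x hx
    have h1 : HasFDerivAt (fun x => H x + ψ (H x) • v)
        (fderiv ℝ H x + ((fderiv ℝ ψ (H x)).comp (fderiv ℝ H x)).smulRight v) x :=
      hx.hasFDerivAt.add ((((hψ.differentiable one_ne_zero) (H x)).hasFDerivAt.comp x
        hx.hasFDerivAt).smul_const v)
    rw [h1.fderiv, det_comp_add_smulRight]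
    ring
  rw [← setIntegral_eq_integral_of_forall_compl_eq_zero (s := s)]
  · rw [setIntegral_congr_ae hs.measurableSet (hae.mono fun x hx _ => hx),
      integral_sub hint' hint, hcongr, sub_self]
  · intro x hx
    have : fderiv ℝ ψ (H x) = 0 :=
      image_eq_zero_of_notMem_tsupport fun h => hout x hx (tsupport_fderiv_subset ℝ h)
    simp [this]

/-- The Jacobian determinant of a bi-Lipschitz bijection has constant sign. -/
theorem exists_sign_det_fderiv {H H' : E → E} {C C' : NNReal}
    (hH : LipschitzWith C H) (hH' : LipschitzWith C' H') (hl : Function.LeftInverse H' H)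
    (hr : Function.RightInverse H' H) :
    ∃ σ : ℝ, (σ = 1 ∨ σ = -1) ∧
      ∀ᵐ x ∂μ, (fderiv ℝ H x).det = σ * |(fderiv ℝ H x).det| := by
  -- The sign of the Jacobian, transported to the target. The value at zero Jacobian is immaterial,
  -- as it is multiplied by `|det|`.
  set θ : E → ℝ := fun y => if 0 < (fderiv ℝ H (H' y)).det then 1 else -1
  have hJ : Measurable fun x => (fderiv ℝ H x).det :=
    measurable_comp_fderiv H ContinuousLinearMap.continuous_det
  have hθ : Measurable θ := Measurable.ite
    (measurableSet_lt measurable_const (hJ.comp hH'.continuous.measurable))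
    measurable_const measurable_const
  have hθv : ∀ y, θ y = 1 ∨ θ y = -1 := fun y => by
    by_cases h : 0 < (fderiv ℝ H (H' y)).det <;> simp [θ, h]
  have hθJ : ∀ x, (fderiv ℝ H x).det = θ (H x) * |(fderiv ℝ H x).det| := fun x => by
    by_cases h : 0 < (fderiv ℝ H x).det
    · simp [θ, hl x, h, abs_of_pos h]
    · simp [θ, hl x, h, abs_of_nonpos (not_lt.1 h)]
  obtain ⟨y₀, hy₀⟩ := exists_ae_eq_const_of_integral_fderiv_eq_zero μ hθ (M := 1)
    (fun y => by rcases hθv y with h | h <;> simp [h]) (fun ψ hψ hψs v => by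
      rw [hH.integral_comp_bijective μ ⟨hl.injective, hr.surjective⟩,
        ← integral_fderiv_comp_mul_det_eq_zero μ hH hH' hl hψ hψs v]
      refine integral_congr_ae (ae_of_all _ fun x => ?_)
      simp only [smul_eq_mul]
      linear_combination (-(fderiv ℝ ψ (H x) v)) * hθJ x)
  refine ⟨θ y₀, hθv y₀, ?_⟩
  filter_upwards [hH'.ae_comp_of_leftInverse μ hl hy₀] with x hx
  rw [← hx]
  exact hθJ x

end JacobianSign

/-! ### Homogeneous extensions and the radial retraction -/

section Homogeneous

variable {E F : Type*} [NormedAddCommGroup E] [NormedSpace ℝ E] [NormedAddCommGroup F]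
  [NormedSpace ℝ F]

/-- Keeping `b • b⁻¹ • y` in place of `y` avoids the hypothesis `b ≠ 0`. -/
theorem mul_norm_inv_smul_sub_le {a b : ℝ} (ha : 0 < a) (x y : E) :
    a * ‖a⁻¹ • x - b⁻¹ • y‖ ≤ ‖x - b • b⁻¹ • y‖ + |a - b| * ‖b⁻¹ • y‖ := by
  have h : a • (a⁻¹ • x - b⁻¹ • y) = (x - b • b⁻¹ • y) - (a - b) • b⁻¹ • y := by
    rw [smul_sub, smul_smul, mul_inv_cancel₀ ha.ne', one_smul, sub_smul]
    abel
  have h' : ‖a • (a⁻¹ • x - b⁻¹ • y)‖ = a * ‖a⁻¹ • x - b⁻¹ • y‖ := by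
    rw [norm_smul, Real.norm_of_nonneg ha.le]
  rw [← h', h, ← Real.norm_eq_abs, ← norm_smul]
  exact norm_sub_le _ _

/-- The positively homogeneous extension of a map `k` from the level set `ν = 1`. -/
noncomputable def coneExtension (ν : E → ℝ) (k : E → F) (z : E) : F :=
  ν z • k ((ν z)⁻¹ • z)

/-- Normalizing to the level set is Lipschitz only up to a factor `1 / ν x`, which the outer factor
`ν x` cancels. The variation of `ν` itself is paired with the bound `M` on `k`. -/
theorem lipschitzWith_coneExtension {ν : E → ℝ} {k : E → F} {C D : NNReal} {c : ℝ}
    (hν : LipschitzWith C ν) (hhom : ∀ r : ℝ, 0 < r → ∀ z, ν (r • z) = r * ν z) (hc : 0 < c)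
    (hcν : ∀ z, c * ‖z‖ ≤ ν z) (hk : LipschitzOnWith D k {z | ν z = 1})
    {M : ℝ} (hM0 : 0 ≤ M) (hM : ∀ z, ν z = 1 → ‖k z‖ ≤ M) :
    ∃ C' : NNReal, LipschitzWith C' (coneExtension ν k) := by
  have h0 : ν 0 = 0 := by
    have := hhom 2 two_pos 0
    rw [smul_zero] at this
    linarith
  have hpos : ∀ z, z ≠ 0 → 0 < ν z := fun z hz =>
    (mul_pos hc (norm_pos_iff.2 hz)).trans_le (hcν z)
  have h1 : ∀ z, z ≠ 0 → ν ((ν z)⁻¹ • z) = 1 := fun z hz => by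
    rw [hhom _ (inv_pos.2 (hpos z hz)), inv_mul_cancel₀ (hpos z hz).ne']
  have hdiff : ∀ x y, |ν x - ν y| ≤ C * ‖x - y‖ := fun x y => by
    simpa [Real.dist_eq, dist_eq_norm] using hν.dist_le_mul x y
  have hbound : ∀ z, ‖coneExtension ν k z‖ ≤ M * ν z := by
    intro z
    by_cases hz : z = 0
    · simp [coneExtension, hz, h0]
    · rw [coneExtension, norm_smul, Real.norm_of_nonneg (hpos z hz).le, mul_comm]
      exact mul_le_mul_of_nonneg_right (hM _ (h1 z hz)) (hpos z hz).le
  have hzero : coneExtension ν k 0 = 0 := by simp [coneExtension, h0]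
  have hx0 : ∀ x, ‖coneExtension ν k x‖ ≤ M * C * ‖x‖ := by
    intro x
    refine (hbound x).trans ?_
    rw [mul_assoc]
    refine mul_le_mul_of_nonneg_left ?_ hM0
    have := hdiff x 0
    rw [h0, sub_zero, sub_zero] at this
    exact (le_abs_self _).trans this
  refine ⟨(D * (1 + C / c) + M * C).toNNReal, LipschitzWith.of_dist_le_mul fun x y => ?_⟩
  rw [dist_eq_norm, dist_eq_norm, Real.coe_toNNReal _ (by positivity)]
  have hD0 : 0 ≤ D * (1 + C / c) * ‖x - y‖ := by positivity
  rw [add_mul]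
  by_cases hx : x = 0
  · subst hx
    rw [hzero, zero_sub, norm_neg]
    have := hx0 y
    rw [zero_sub, norm_neg] at hD0 ⊢
    linarith
  by_cases hy : y = 0
  · subst hy
    rw [hzero, sub_zero]
    have := hx0 x
    rw [sub_zero] at hD0 ⊢
    linarith
  have hνx := hpos x hx
  have hνy := hpos y hy
  have e1 : coneExtension ν k x - coneExtension ν k y =
      ν x • (k ((ν x)⁻¹ • x) - k ((ν y)⁻¹ • y)) + (ν x - ν y) • k ((ν y)⁻¹ • y) := by
    simp only [coneExtension, smul_sub, sub_smul]
    abel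
  have e2 : ‖k ((ν x)⁻¹ • x) - k ((ν y)⁻¹ • y)‖ ≤ D * ‖(ν x)⁻¹ • x - (ν y)⁻¹ • y‖ := by
    simpa [dist_eq_norm] using hk.dist_le_mul _ (h1 x hx) _ (h1 y hy)
  have e3 := mul_norm_inv_smul_sub_le (b := ν y) hνx x y
  rw [smul_smul, mul_inv_cancel₀ hνy.ne', one_smul] at e3
  have e4 : ‖(ν y)⁻¹ • y‖ ≤ 1 / c := by
    rw [le_div_iff₀ hc, mul_comm, ← h1 y hy]
    exact hcν _
  rw [e1]
  refine (norm_add_le _ _).trans (add_le_add ?_ ?_)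
  · rw [norm_smul, Real.norm_of_nonneg hνx.le]
    calc ν x * ‖k ((ν x)⁻¹ • x) - k ((ν y)⁻¹ • y)‖
        ≤ ν x * (D * ‖(ν x)⁻¹ • x - (ν y)⁻¹ • y‖) := mul_le_mul_of_nonneg_left e2 hνx.le
      _ = D * (ν x * ‖(ν x)⁻¹ • x - (ν y)⁻¹ • y‖) := by ring
      _ ≤ D * (‖x - y‖ + (C * ‖x - y‖) * (1 / c)) := by
          refine mul_le_mul_of_nonneg_left (e3.trans ?_) D.coe_nonneg
          gcongr
          exact hdiff x y
      _ = D * (1 + C / c) * ‖x - y‖ := by ring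
  · rw [norm_smul, Real.norm_eq_abs]
    calc |ν x - ν y| * ‖k ((ν y)⁻¹ • y)‖ ≤ (C * ‖x - y‖) * M :=
          mul_le_mul (hdiff x y) (hM _ (h1 y hy)) (norm_nonneg _) (by positivity)
      _ = M * C * ‖x - y‖ := by ring

/-- The radial retraction onto the closed unit ball. -/
noncomputable def radialRetraction (x : E) : E := (max 1 ‖x‖)⁻¹ • x

theorem lipschitzWith_radialRetraction : LipschitzWith 2 (radialRetraction : E → E) := by
  refine LipschitzWith.of_dist_le_mul fun x y => ?_
  have hx : 1 ≤ max 1 ‖x‖ := le_max_left _ _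
  have hy : 1 ≤ max 1 ‖y‖ := le_max_left _ _
  have hx0 : 0 < max 1 ‖x‖ := one_pos.trans_le hx
  have hy0 : 0 < max 1 ‖y‖ := one_pos.trans_le hy
  have e3 := mul_norm_inv_smul_sub_le (b := max 1 ‖y‖) hx0 x y
  rw [smul_smul, mul_inv_cancel₀ hy0.ne', one_smul] at e3
  have e4 : ‖(max 1 ‖y‖)⁻¹ • y‖ ≤ 1 := by
    rw [norm_smul, norm_inv, Real.norm_of_nonneg hy0.le, inv_mul_le_iff₀ hy0, mul_one]
    exact le_max_right _ _
  have e5 : |max 1 ‖x‖ - max 1 ‖y‖| ≤ ‖x - y‖ := by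
    have := abs_max_sub_max_le_max 1 ‖x‖ 1 ‖y‖
    simp only [sub_self, abs_zero] at this
    exact this.trans (max_le (norm_nonneg _) (abs_norm_sub_norm_le _ _))
  rw [dist_eq_norm, dist_eq_norm]
  calc ‖radialRetraction x - radialRetraction y‖
      ≤ max 1 ‖x‖ * ‖(max 1 ‖x‖)⁻¹ • x - (max 1 ‖y‖)⁻¹ • y‖ :=
        le_mul_of_one_le_left (norm_nonneg _) hx
    _ ≤ ‖x - y‖ + ‖x - y‖ * 1 := by
        refine e3.trans ?_
        gcongr
    _ = _ := by push_cast; ring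

theorem radialRetraction_of_mem {x : E} (hx : ‖x‖ ≤ 1) : radialRetraction x = x := by
  simp [radialRetraction, max_eq_left hx]

theorem norm_radialRetraction_le (x : E) : ‖radialRetraction x‖ ≤ 1 := by
  have hx0 : 0 < max 1 ‖x‖ := one_pos.trans_le (le_max_left _ _)
  rw [radialRetraction, norm_smul, norm_inv, Real.norm_of_nonneg hx0.le, inv_mul_le_iff₀ hx0,
    mul_one]
  exact le_max_right _ _

theorem norm_radialRetraction_of_le {x : E} (hx : 1 ≤ ‖x‖) : ‖radialRetraction x‖ = 1 := by
  have hx0 : 0 < ‖x‖ := one_pos.trans_le hx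
  rw [radialRetraction, max_eq_right hx, norm_smul, norm_inv, norm_norm, inv_mul_cancel₀ hx0.ne']

end Homogeneous

/-! ### Constant forms on Lipschitz disks -/

section AlternatingForms

variable {W : Type*} [NormedAddCommGroup W] [NormedSpace ℝ W] [FiniteDimensional ℝ W]
  {n : ℕ} {ι : Type*} [Fintype ι]

/-- The map to `ℝⁿ` whose coordinates are chosen among those of a basis. -/
noncomputable def coordSelect (b : Module.Basis ι ℝ W) (k : Fin n → ι) : W →L[ℝ] VSpace n :=
  (EuclideanSpace.equiv (Fin n) ℝ).symm.toContinuousLinearMap.comp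
    (LinearMap.toContinuousLinearMap (LinearMap.pi fun i => b.coord (k i)))

theorem coordSelect_apply (b : Module.Basis ι ℝ W) (k : Fin n → ι) (w : W) (i : Fin n) :
    coordSelect b k w i = b.coord (k i) w := rfl

theorem det_eq_det_apply_single (M : VSpace n →L[ℝ] VSpace n) :
    M.det = Matrix.det (Matrix.of fun i j => M (EuclideanSpace.single j 1) i) := by
  rw [ContinuousLinearMap.det,
    ← LinearMap.det_toMatrix (EuclideanSpace.basisFun (Fin n) ℝ).toBasis]
  congr 1

/-- Expanding in the basis and averaging over permutations writes the form as a combination of `n ×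
n` minors. Facts about Jacobian determinants thus pass to all constant forms. -/
theorem AlternatingMap.apply_eq_sum_det [DecidableEq ι] (b : Module.Basis ι ℝ W)
    (A : W [⋀^Fin n]→ₗ[ℝ] ℝ) (D : VSpace n →L[ℝ] W) :
    A (fun i => D (EuclideanSpace.single i 1)) = (n.factorial : ℝ)⁻¹ *
      ∑ k : Fin n → ι, A (fun i => b (k i)) * ((coordSelect b k).comp D).det := by
  set v : Fin n → W := fun i => D (EuclideanSpace.single i 1)
  have h1 : ∀ u : Fin n → W, A u =
      ∑ k : Fin n → ι, (∏ j, b.coord (k j) (u j)) * A (fun i => b (k i)) := by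
    intro u
    conv_lhs => rw [show u = fun j => ∑ i, b.coord i (u j) • b i from
      funext fun j => (b.sum_repr (u j)).symm]
    rw [← AlternatingMap.coe_multilinearMap, MultilinearMap.map_sum]
    refine Finset.sum_congr rfl fun k _ => ?_
    rw [MultilinearMap.map_smul_univ, smul_eq_mul]
  have h2 : (n.factorial : ℝ) * A v =
      ∑ σ : Equiv.Perm (Fin n), ((Equiv.Perm.sign σ : ℤ) : ℝ) * A (v ∘ σ) := by
    have : ∀ σ : Equiv.Perm (Fin n),
        ((Equiv.Perm.sign σ : ℤ) : ℝ) * A (v ∘ σ) = A v := fun σ => by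
      rw [AlternatingMap.map_perm, Units.smul_def, zsmul_eq_mul, ← mul_assoc, ← Int.cast_mul,
        ← Units.val_mul, Int.units_mul_self]
      simp
    simp [this, Fintype.card_perm]
  have hn : (n.factorial : ℝ) ≠ 0 := by exact_mod_cast n.factorial_ne_zero
  rw [eq_inv_mul_iff_mul_eq₀ hn, h2, Finset.sum_congr rfl fun σ _ => by rw [h1 (v ∘ σ), Finset.mul_sum],
    Finset.sum_comm]
  refine Finset.sum_congr rfl fun k _ => ?_
  rw [det_eq_det_apply_single, ← Matrix.det_transpose, Matrix.det_apply', Finset.mul_sum]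
  refine Finset.sum_congr rfl fun σ _ => ?_
  simp only [Matrix.transpose_apply, Matrix.of_apply, ContinuousLinearMap.comp_apply,
    coordSelect_apply, Function.comp_apply, v]
  ring

theorem AlternatingMap.continuous_apply_comp (A : W [⋀^Fin n]→ₗ[ℝ] ℝ) :
    Continuous fun D : VSpace n →L[ℝ] W => A fun i => D (EuclideanSpace.single i 1) := by
  classical
  simp_rw [AlternatingMap.apply_eq_sum_det (Module.finBasis ℝ W) A]
  refine continuous_const.mul (continuous_finsetSum _ fun k _ => continuous_const.mul ?_)
  exact ContinuousLinearMap.continuous_det.comp (by fun_prop)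

theorem AlternatingMap.apply_comp_comp (A : W [⋀^Fin n]→ₗ[ℝ] ℝ) (D : VSpace n →L[ℝ] W)
    (M : VSpace n →L[ℝ] VSpace n) :
    (A fun i => (D.comp M) (EuclideanSpace.single i 1)) =
      M.det * A fun i => D (EuclideanSpace.single i 1) := by
  classical
  rw [AlternatingMap.apply_eq_sum_det (Module.finBasis ℝ W) A,
    AlternatingMap.apply_eq_sum_det (Module.finBasis ℝ W) A, mul_left_comm]
  congr 1
  rw [Finset.mul_sum]
  refine Finset.sum_congr rfl fun k _ => ?_
  have : ((coordSelect (Module.finBasis ℝ W) k).comp (D.comp M)).det =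
      ((coordSelect (Module.finBasis ℝ W) k).comp D).det * M.det :=
    LinearMap.det_comp (((coordSelect (Module.finBasis ℝ W) k).comp D).toLinearMap) M.toLinearMap
  rw [this]
  ring

theorem setIntegral_form_fderiv_congr (A : W [⋀^Fin n]→ₗ[ℝ] ℝ) {G₁ G₂ : VSpace n → W}
    {C₁ C₂ : NNReal} (h₁ : LipschitzWith C₁ G₁) (h₂ : LipschitzWith C₂ G₂) {s : Set (VSpace n)}
    (hs : MeasurableSet s) (hμ : volume s ≠ ⊤) (h : EqOn G₁ G₂ sᶜ) :
    ∫ x in s, A (fun i => fderiv ℝ G₁ x (EuclideanSpace.single i 1)) =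
      ∫ x in s, A (fun i => fderiv ℝ G₂ x (EuclideanSpace.single i 1)) := by
  classical
  set b := Module.finBasis ℝ W
  have key : ∀ {G : VSpace n → W} {C : NNReal}, LipschitzWith C G →
      ∫ x in s, A (fun i => fderiv ℝ G x (EuclideanSpace.single i 1)) =
        (n.factorial : ℝ)⁻¹ * ∑ k : Fin n → Fin (Module.finrank ℝ W),
          A (fun i => b (k i)) * ∫ x in s, (fderiv ℝ (coordSelect b k ∘ G) x).det := by
    intro G C hG
    have hae : ∀ k, ∀ᵐ x ∂(volume : Measure (VSpace n)),
        (fderiv ℝ (coordSelect b k ∘ G) x).det = ((coordSelect b k).comp (fderiv ℝ G x)).det := by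
      intro k
      filter_upwards [hG.ae_differentiableAt] with x hx
      rw [((coordSelect b k).hasFDerivAt.comp x hx.hasFDerivAt).fderiv]
    have hint : ∀ k, IntegrableOn (fun x => ((coordSelect b k).comp (fderiv ℝ G x)).det) s := by
      intro k
      refine IntegrableOn.congr_fun_ae (((coordSelect b k).lipschitz.comp hG).integrableOn_comp_fderiv volume
        ContinuousLinearMap.continuous_det hμ) (ae_restrict_of_ae (hae k))
    simp_rw [AlternatingMap.apply_eq_sum_det b A]
    rw [integral_const_mul, integral_finsetSum _ fun k _ => (hint k).const_mul _]
    congr 1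
    refine Finset.sum_congr rfl fun k _ => ?_
    rw [integral_const_mul]
    congr 1
    exact setIntegral_congr_ae hs ((hae k).mono fun x hx _ => hx.symm)
  rw [key h₁, key h₂]
  congr 1
  refine Finset.sum_congr rfl fun k _ => ?_
  congr 1
  exact setIntegral_det_fderiv_congr volume ((coordSelect b k).lipschitz.comp h₁)
    ((coordSelect b k).lipschitz.comp h₂) hs hμ fun x hx => by simp [h hx]

theorem ball_ae_eq_closedBall {E : Type*} [NormedAddCommGroup E] [NormedSpace ℝ E]
    [FiniteDimensional ℝ E] [MeasurableSpace E] [BorelSpace E] (μ : Measure E)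
    [μ.IsAddHaarMeasure] [Nontrivial E] : (ball (0 : E) 1 : Set E) =ᵐ[μ] closedBall (0 : E) 1 := by
  refine ball_subset_closedBall.eventuallyLE.antisymm ?_
  rw [ae_le_set, closedBall_sdiff_ball]
  exact Measure.addHaar_sphere μ 0 1

/-- Outside the ball this extension sees only boundary values, so disks with equal boundary values
extend to maps that agree off the ball. -/
theorem lipschitzWith_comp_radialRetraction {E F : Type*} [NormedAddCommGroup E] [NormedSpace ℝ E]
    [NormedAddCommGroup F] {f : E → F} {C : NNReal} (hf : LipschitzOnWith C f (closedBall 0 1)) :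
    LipschitzWith (C * 2) (f ∘ radialRetraction) :=
  lipschitzOnWith_univ.1 (hf.comp lipschitzWith_radialRetraction.lipschitzOnWith
    fun x _ => by simpa using norm_radialRetraction_le x)

theorem fderiv_comp_radialRetraction {E F : Type*} [NormedAddCommGroup E] [NormedSpace ℝ E]
    [NormedAddCommGroup F] [NormedSpace ℝ F] (f : E → F) {x : E} (hx : x ∈ ball (0 : E) 1) :
    fderiv ℝ (f ∘ radialRetraction) x = fderiv ℝ f x := by
  refine Filter.EventuallyEq.fderiv_eq ?_
  filter_upwards [isOpen_ball.mem_nhds hx] with y hy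
  rw [Function.comp_apply, radialRetraction_of_mem (by simpa using (mem_ball_zero_iff.1 hy).le)]

theorem setIntegral_comp_radialRetraction [NeZero n] (f : VSpace n → W)
    (φ : (VSpace n →L[ℝ] W) → ℝ) :
    ∫ x in closedBall 0 1, φ (fderiv ℝ (f ∘ radialRetraction) x) =
      ∫ x in closedBall 0 1, φ (fderiv ℝ f x) := by
  rw [← setIntegral_congr_set (ball_ae_eq_closedBall volume),
    ← setIntegral_congr_set (ball_ae_eq_closedBall volume)]
  exact setIntegral_congr_fun measurableSet_ball fun x hx => by
    simp only [fderiv_comp_radialRetraction f hx]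

/-- The integral of a constant-coefficient form over a Lipschitz disk depends only on the boundary
values. -/
theorem setIntegral_closedBall_form_congr [NeZero n] (A : W [⋀^Fin n]→ₗ[ℝ] ℝ)
    {f g : VSpace n → W} {C D : NNReal} (hf : LipschitzOnWith C f (closedBall 0 1))
    (hg : LipschitzOnWith D g (closedBall 0 1)) (h : EqOn f g (sphere 0 1)) :
    ∫ x in closedBall 0 1, A (fun i => fderiv ℝ f x (EuclideanSpace.single i 1)) =
      ∫ x in closedBall 0 1, A (fun i => fderiv ℝ g x (EuclideanSpace.single i 1)) := by
  rw [← setIntegral_comp_radialRetraction f fun D => A fun i => D (EuclideanSpace.single i 1),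
    ← setIntegral_comp_radialRetraction g fun D => A fun i => D (EuclideanSpace.single i 1)]
  refine setIntegral_form_fderiv_congr A (lipschitzWith_comp_radialRetraction hf)
    (lipschitzWith_comp_radialRetraction hg) measurableSet_closedBall
    (isCompact_closedBall _ _).measure_ne_top fun x hx => ?_
  refine h ?_
  rw [mem_sphere_zero_iff_norm]
  refine norm_radialRetraction_of_le ?_
  have : ¬ ‖x‖ ≤ 1 := by simpa using hx
  exact (not_le.1 this).le

end AlternatingForms

/-! ### Integrals of `exp (-ρ)` for homogeneous `ρ` -/

section ExponentialIntegral

variable {E : Type*} [NormedAddCommGroup E] [NormedSpace ℝ E] [FiniteDimensional ℝ E]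
  [MeasurableSpace E] [BorelSpace E] (μ : Measure E) [μ.IsAddHaarMeasure]

open scoped Pointwise in
theorem setIntegral_sublevel_eq_pow_mul {ρ F : E → ℝ}
    (hhom : ∀ r : ℝ, 0 < r → ∀ x, ρ (r • x) = r * ρ x)
    (hF : ∀ r : ℝ, 0 < r → ∀ x, F (r • x) = F x) {r : ℝ} (hr : 0 < r) :
    ∫ x in {x | ρ x ≤ r}, F x ∂μ = r ^ Module.finrank ℝ E * ∫ x in {x | ρ x ≤ 1}, F x ∂μ := by
  have h := Measure.setIntegral_comp_smul_of_pos μ F {x | ρ x ≤ 1} hr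
  have hs : r • {x | ρ x ≤ 1} = {x | ρ x ≤ r} := by
    ext x
    rw [mem_smul_set_iff_inv_smul_mem₀ hr.ne']
    simp only [mem_ofPred_eq, hhom _ (inv_pos.2 hr)]
    rw [inv_mul_le_iff₀ hr, mul_one]
  simp only [hF r hr, hs, smul_eq_mul] at h
  rw [h, mul_inv_cancel_left₀ (pow_pos hr _).ne']

/-- The layer-cake formula for `exp (-ρ)`, with `ρ` homogeneous of degree one. -/
theorem integral_exp_neg_mul_of_homogeneous {ρ F : E → ℝ} (hρ : Measurable ρ)
    (hhom : ∀ r : ℝ, 0 < r → ∀ x, ρ (r • x) = r * ρ x) {c : ℝ} (hc : 0 < c)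
    (hcρ : ∀ x, c * ‖x‖ ≤ ρ x) (hFm : Measurable F) {M : ℝ} (hM : ∀ x, ‖F x‖ ≤ M)
    (hF : ∀ r : ℝ, 0 < r → ∀ x, F (r • x) = F x) :
    Integrable (fun x => Real.exp (-ρ x) * F x) μ ∧
      ∫ x, Real.exp (-ρ x) * F x ∂μ =
        (Module.finrank ℝ E).factorial * ∫ x in {x | ρ x ≤ 1}, F x ∂μ := by
  set d := Module.finrank ℝ E
  -- The layers come from `exp (-ρ x) = ∫ r in Ioi (ρ x), exp (-r)`.
  set κ : E → ℝ → ℝ := fun x r => {x | ρ x ≤ r}.indicator (fun x => Real.exp (-r) * F x) x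
  have hρ0 : ∀ x, 0 ≤ ρ x := fun x => (by positivity : 0 ≤ c * ‖x‖).trans (hcρ x)
  have hlevel : ∀ r, MeasurableSet {x | ρ x ≤ r} := fun r => hρ measurableSet_Iic
  have hfin : ∀ r, μ {x | ρ x ≤ r} ≠ ⊤ := fun r => by
    refine ne_top_of_le_ne_top (IsCompact.measure_ne_top (μ := μ)
      (isCompact_closedBall (0 : E) (r / c))) (measure_mono fun x hx => ?_)
    rw [mem_closedBall_zero_iff, le_div_iff₀ hc, mul_comm]
    exact (hcρ x).trans hx
  have hFint : ∀ r, IntegrableOn F {x | ρ x ≤ r} μ := fun r =>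
    Measure.integrableOn_of_bounded (hfin r) hFm.aestronglyMeasurable (ae_of_all _ hM)
  have hκint : ∀ r, Integrable (fun x => κ x r) μ := fun r => by
    simp only [κ]
    exact (integrable_indicator_iff (hlevel r)).2 ((hFint r).const_mul _)
  have hκx : ∀ x, ∫ r in Ioi (0 : ℝ), κ x r = Real.exp (-ρ x) * F x := by
    intro x
    have h1 : ∀ r, κ x r = (Ici (ρ x)).indicator (fun r => Real.exp (-r) * F x) r := fun r => by
      simp only [κ, indicator, mem_ofPred_eq, mem_Ici]
    simp_rw [h1]
    rw [setIntegral_indicator measurableSet_Ici, integral_mul_const,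
      setIntegral_congr_set (t := Ioi (ρ x)), integral_exp_neg_Ioi]
    refine (Filter.EventuallyEq.rfl.inter Ioi_ae_eq_Ici.symm).trans ?_
    rw [inter_eq_right.2 (Ioi_subset_Ioi (hρ0 x))]
    exact Filter.EventuallyEq.rfl
  -- The exponent is written `(d + 1) - 1` to match the integrand of `Γ (d + 1) = d!`. A general `G`
  -- allows both `F` and `‖F‖`.
  have hκr : ∀ G : E → ℝ, (∀ r : ℝ, 0 < r → ∀ x, G (r • x) = G x) → ∀ r ∈ Ioi (0 : ℝ),
      ∫ x, {x | ρ x ≤ r}.indicator (fun x => Real.exp (-r) * G x) x ∂μ =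
        Real.exp (-r) * r ^ ((d + 1 : ℝ) - 1) * ∫ x in {x | ρ x ≤ 1}, G x ∂μ := by
    intro G hG r hr
    rw [integral_indicator (hlevel r), integral_const_mul,
      setIntegral_sublevel_eq_pow_mul μ hhom hG hr, add_sub_cancel_right, Real.rpow_natCast,
      mul_assoc]
  have hmeas : Measurable fun z : E × ℝ => κ z.1 z.2 := by
    have : (fun z : E × ℝ => κ z.1 z.2) =
        {z : E × ℝ | ρ z.1 ≤ z.2}.indicator fun z => Real.exp (-z.2) * F z.1 := by
      ext z
      simp only [κ, indicator, mem_ofPred_eq]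
    rw [this]
    exact Measurable.indicator (by fun_prop)
      (measurableSet_le (hρ.comp measurable_fst) measurable_snd)
  have hd : (0 : ℝ) < d + 1 := by positivity
  have hint : Integrable (fun z : E × ℝ => κ z.1 z.2) (μ.prod (volume.restrict (Ioi 0))) := by
    rw [integrable_prod_iff' hmeas.aestronglyMeasurable]
    refine ⟨ae_of_all _ hκint, ?_⟩
    refine IntegrableOn.congr_fun ((Real.GammaIntegral_convergent hd).mul_const
      (∫ x in {x | ρ x ≤ 1}, ‖F x‖ ∂μ)) (fun r hr => ?_) measurableSet_Ioi
    rw [← hκr (fun x => ‖F x‖) (fun r hr x => by rw [hF r hr]) r hr]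
    refine integral_congr_ae (ae_of_all _ fun x => ?_)
    simp only [κ, norm_indicator_eq_indicator_norm, norm_mul, Real.norm_eq_abs, Real.abs_exp]
  refine ⟨?_, ?_⟩
  · have := hint.integral_prod_left
    simpa only [hκx] using this
  · simp_rw [← hκx]
    rw [integral_integral_swap hint, setIntegral_congr_fun measurableSet_Ioi (hκr F hF),
      integral_mul_const, ← Real.Gamma_eq_integral hd, Real.Gamma_nat_eq_factorial]

end ExponentialIntegral

/-! ### The Moreau decomposition attached to a convex body -/

section PolarSplitting

open scoped RealInnerProductSpace

variable {n : ℕ} {K : Set (VSpace n)}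

theorem IsSymmetricConvexBody.mem_nhds_zero (hK : IsSymmetricConvexBody K) :
    K ∈ nhds (0 : VSpace n) := by
  obtain ⟨x, hx⟩ := hK.nonempty_interior
  have h := hK.convex.combo_interior_self_mem_interior hx (hK.neg_mem x (interior_subset hx))
    one_half_pos one_half_pos.le (by norm_num)
  rw [smul_neg, add_neg_cancel] at h
  exact mem_interior_iff_mem_nhds.1 h

theorem IsSymmetricConvexBody.gauge_le_one_iff (hK : IsSymmetricConvexBody K) {x : VSpace n} :
    gauge K x ≤ 1 ↔ x ∈ K := by
  rw [gauge_le_one_iff_mem_closure hK.convex hK.mem_nhds_zero, hK.isCompact.isClosed.closure_eq]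

theorem nonneg_of_forall_mul_add_sq_mul_nonneg {a b : ℝ} (hb : 0 ≤ b)
    (h : ∀ t, 0 ≤ t → t ≤ 1 → 0 ≤ t * a + t ^ 2 * b) : 0 ≤ a := by
  by_contra ha
  rw [not_le] at ha
  have hd : 0 < 2 * (b - a) := by linarith
  have ht := h (-a / (2 * (b - a))) (by apply div_nonneg <;> linarith)
    (by rw [div_le_one hd]; linarith)
  have h2 : -a / (2 * (b - a)) * a + (-a / (2 * (b - a))) ^ 2 * b =
      -(a ^ 2 * (b - 2 * a)) / (2 * (b - a)) ^ 2 := by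
    field_simp
    ring
  rw [h2] at ht
  have : -(a ^ 2 * (b - 2 * a)) / (2 * (b - a)) ^ 2 < 0 := by
    apply div_neg_of_neg_of_pos
    · have : 0 < a ^ 2 * (b - 2 * a) := by
        have : 0 < a ^ 2 := sq_pos_of_neg ha
        nlinarith
      linarith
    · positivity
  linarith

/-- Every vector `z` is the sum of a multiple `s a` of a point of `K` and the same multiple `s b`
of a point of its polar body with `⟨a, b⟩ = 1`. -/
theorem IsSymmetricConvexBody.exists_polar_decomposition (hK : IsSymmetricConvexBody K)
    (z : VSpace n) : ∃ p q : VSpace n, p + q = z ∧ ⟪p, q⟫ = gauge K p ^ 2 ∧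
      ∀ x, |⟪x, q⟫| ≤ gauge K p * gauge K x := by
  have h0 := hK.mem_nhds_zero
  have hcont : Continuous (gauge K) := continuous_gauge hK.convex h0
  have habs : Absorbent ℝ K := absorbent_nhds_zero h0
  have hneg : ∀ x, gauge K (-x) = gauge K x := fun x => gauge_neg hK.neg_mem x
  -- The minimizer `p` is the proximal point of half the squared gauge.
  set H : VSpace n → ℝ := fun p => gauge K p ^ 2 + ‖z - p‖ ^ 2
  have hH : Continuous H := by fun_prop
  obtain ⟨p, hp⟩ := hH.exists_forall_le' z (by
    filter_upwards [(isCompact_closedBall z (gauge K z)).compl_mem_cocompact] with x hx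
    have hx' : gauge K z ≤ ‖z - x‖ := by
      rw [mem_compl_iff, mem_closedBall, not_le, dist_comm, dist_eq_norm] at hx
      exact hx.le
    have := pow_le_pow_left₀ (gauge_nonneg z) hx' 2
    simp only [H, sub_self, norm_zero]
    nlinarith [sq_nonneg (gauge K x)])
  set q := z - p
  -- First-order optimality on the segment from `p` to `p'`, by convexity of the gauge.
  have key : ∀ p', 0 ≤ gauge K p * (gauge K p' - gauge K p) - ⟪q, p' - p⟫ := by
    intro p'
    refine nonneg_of_forall_mul_add_sq_mul_nonneg
      (b := ((gauge K p' - gauge K p) ^ 2 + ‖p' - p‖ ^ 2) / 2) (by positivity) fun t ht0 ht1 => ?_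
    have h1 := hp (p + t • (p' - p))
    have h2 : gauge K (p + t • (p' - p)) ≤ gauge K p + t * (gauge K p' - gauge K p) := by
      have e : p + t • (p' - p) = (1 - t) • p + t • p' := by module
      rw [e]
      refine (gauge_add_le hK.convex habs _ _).trans ?_
      rw [gauge_smul_of_nonneg (sub_nonneg.2 ht1), gauge_smul_of_nonneg ht0, smul_eq_mul,
        smul_eq_mul]
      linarith
    have h3 := pow_le_pow_left₀ (gauge_nonneg _) h2 2
    have h4 : ‖z - (p + t • (p' - p))‖ ^ 2 =
        ‖q‖ ^ 2 - 2 * (t * ⟪q, p' - p⟫) + t ^ 2 * ‖p' - p‖ ^ 2 := by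
      rw [← sub_sub, norm_sub_sq_real, real_inner_smul_right, norm_smul, mul_pow,
        Real.norm_eq_abs, sq_abs]
    simp only [H] at h1
    rw [h4] at h1
    nlinarith
  -- The competitors `0` and `2 p` give the two opposite inequalities (Euler's relation).
  have hpq : ⟪p, q⟫ = gauge K p ^ 2 := by
    have h1 := key 0
    have h2 := key ((2 : ℝ) • p)
    rw [gauge_zero, zero_sub, zero_sub, inner_neg_right] at h1
    rw [show (2 : ℝ) • p - p = p by module, gauge_smul_of_nonneg two_pos.le, smul_eq_mul] at h2
    rw [real_inner_comm]
    nlinarith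
  have hle : ∀ x, ⟪x, q⟫ ≤ gauge K p * gauge K x := fun x => by
    have h1 := key x
    rw [inner_sub_right, real_inner_comm x q, real_inner_comm p q, hpq] at h1
    nlinarith
  refine ⟨p, q, add_sub_cancel p z, hpq, fun x => abs_le.2 ⟨?_, hle x⟩⟩
  have := hle (-x)
  rw [inner_neg_left, hneg] at this
  linarith

/-- A splitting `z = p z + q z` of the identity of `ℝⁿ` for which the points `(p z, q z)` form the
positive cone over the set `K⁺` of some body `K`, which is the level set `s = 1`. -/
structure IsPolarSplitting (p q : VSpace n → VSpace n) (s : VSpace n → ℝ) : Prop where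
  add : ∀ z, p z + q z = z
  nonneg : ∀ z, 0 ≤ s z
  inner_self : ∀ z, ⟪p z, q z⟫ = s z ^ 2
  abs_inner_le : ∀ z z', |⟪p z, q z'⟫| ≤ s z * s z'
  lower : ∃ c, 0 < c ∧ ∀ z, c * ‖z‖ ≤ s z
  smul_fst : ∀ (r : ℝ) z, p (r • z) = r • p z
  smul_snd : ∀ (r : ℝ) z, q (r • z) = r • q z
  smul_level : ∀ (r : ℝ) z, s (r • z) = |r| * s z

/-- Sharpened monotonicity: bounding both cross terms by `s * s'` completes a square. All Lipschitz
and uniqueness properties of the splitting rest on it. -/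
theorem sq_sub_le_inner_sub {p q p' q' : VSpace n} {s s' : ℝ} (h : ⟪p, q⟫ = s ^ 2)
    (h' : ⟪p', q'⟫ = s' ^ 2) (h₁ : |⟪p, q'⟫| ≤ s * s') (h₂ : |⟪p', q⟫| ≤ s' * s) :
    (s - s') ^ 2 ≤ ⟪p - p', q - q'⟫ := by
  rw [inner_sub_left, inner_sub_right, inner_sub_right, h, h']
  have := le_of_abs_le h₁
  have := le_of_abs_le h₂
  nlinarith

/-- The differences are opposite, so their inner product is `-‖p - p'‖ ^ 2`. -/
theorem eq_of_add_eq_add_of_inner_nonneg {p q p' q' : VSpace n} (h : p + q = p' + q')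
    (hnn : 0 ≤ ⟪p - p', q - q'⟫) : p = p' ∧ q = q' := by
  have h1 : q - q' = -(p - p') := by
    rw [neg_sub, sub_eq_sub_iff_add_eq_add, add_comm q, h, add_comm]
  rw [h1, inner_neg_right, real_inner_self_eq_norm_sq] at hnn
  have h2 : p - p' = 0 := by
    rw [← norm_eq_zero]
    nlinarith [norm_nonneg (p - p')]
  rw [h2, neg_zero] at h1
  exact ⟨sub_eq_zero.1 h2, sub_eq_zero.1 h1⟩

theorem mem_kPlus_iff (hK : IsSymmetricConvexBody K) {w : WSpace n} :
    w ∈ kPlus K ↔ gauge K w.1 = 1 ∧ ⟪w.1, w.2⟫ = 1 ∧ ∀ x, |⟪x, w.2⟫| ≤ gauge K x := by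
  have h0 := hK.mem_nhds_zero
  have habs : Absorbent ℝ K := absorbent_nhds_zero h0
  have hbd : Bornology.IsVonNBounded ℝ K := hK.isCompact.isVonNBounded ℝ
  constructor
  · rintro ⟨h1, h2, h3⟩
    have hle : ∀ x, |⟪x, w.2⟫| ≤ gauge K x := by
      intro x
      rcases eq_or_ne x 0 with rfl | hx
      · simp
      have hg : 0 < gauge K x := (gauge_pos habs hbd).2 hx
      have hm : (gauge K x)⁻¹ • x ∈ K := by
        rw [← hK.gauge_le_one_iff, gauge_smul_of_nonneg (inv_nonneg.2 hg.le), smul_eq_mul,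
          inv_mul_cancel₀ hg.ne']
      have := abs_le.2 (h2 _ hm)
      rwa [real_inner_smul_left, abs_mul, abs_inv, abs_of_pos hg, inv_mul_le_iff₀ hg,
        mul_one] at this
    refine ⟨le_antisymm (hK.gauge_le_one_iff.2 h1) ?_, h3, hle⟩
    have := hle w.1
    rwa [h3, abs_one] at this
  · rintro ⟨h1, h2, h3⟩
    exact ⟨hK.gauge_le_one_iff.1 h1.le,
      fun x hx => abs_le.1 ((h3 x).trans (hK.gauge_le_one_iff.2 hx)), h2⟩

theorem IsSymmetricConvexBody.exists_isPolarSplitting (hK : IsSymmetricConvexBody K) :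
    ∃ p q s, IsPolarSplitting p q s ∧ kPlus K = {w | ∃ z, s z = 1 ∧ w = (p z, q z)} := by
  choose p q hadd hself hle using hK.exists_polar_decomposition
  have hgs : ∀ (r : ℝ) x, gauge K (r • x) = |r| * gauge K x := fun r x => by
    rcases abs_choice r with h | h
    · rw [h, gauge_smul_of_nonneg (h ▸ abs_nonneg r), smul_eq_mul]
    · rw [← gauge_neg hK.neg_mem, ← neg_smul, h,
        gauge_smul_of_nonneg (h ▸ abs_nonneg r), smul_eq_mul]
  -- Homogeneity follows from uniqueness: `r • p z` and `r • q z` split `r • z`.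
  have hsmul : ∀ (r : ℝ) z, p (r • z) = r • p z ∧ q (r • z) = r • q z := by
    intro r z
    refine eq_of_add_eq_add_of_inner_nonneg (by rw [hadd, ← smul_add, hadd]) ?_
    refine (sq_nonneg (gauge K (p (r • z)) - |r| * gauge K (p z))).trans
      (sq_sub_le_inner_sub (hself _) ?_ ?_ ?_)
    · rw [real_inner_smul_left, real_inner_smul_right, hself, mul_pow, sq_abs]
      ring
    · rw [real_inner_smul_right, abs_mul]
      nlinarith [mul_le_mul_of_nonneg_left (hle z (p (r • z))) (abs_nonneg r)]
    · have := hle (r • z) (r • p z)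
      rw [hgs] at this
      linarith
  have h0 := hK.mem_nhds_zero
  obtain ⟨ε, hε, hball⟩ := Metric.mem_nhds_iff.1 h0
  obtain ⟨R, hR⟩ := hK.isCompact.isBounded.subset_closedBall 0
  have hR0 : 0 < max R 1 := lt_max_of_lt_right one_pos
  have hR' : K ⊆ closedBall 0 (max R 1) := hR.trans (closedBall_subset_closedBall (le_max_left _ _))
  have hpb : ∀ x, ‖x‖ ≤ max R 1 * gauge K x := fun x => by
    have := le_gauge_of_subset_closedBall (absorbent_nhds_zero h0) hR0.le hR' (x := x)
    rwa [div_le_iff₀ hR0, mul_comm] at this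
  have hgb : ∀ x, gauge K x ≤ ‖x‖ / ε := fun x => by
    rw [← gauge_ball hε.le]
    exact gauge_mono (absorbent_ball_zero hε) hball x
  have hqb : ∀ z, ‖q z‖ ≤ gauge K (p z) / ε := fun z => by
    rcases eq_or_ne (q z) 0 with h | h
    · rw [h, norm_zero]
      exact div_nonneg (gauge_nonneg _) hε.le
    have h1 := (le_abs_self _).trans (hle z (q z))
    rw [real_inner_self_eq_norm_sq] at h1
    have h2 : gauge K (p z) * gauge K (q z) ≤ gauge K (p z) * (‖q z‖ / ε) :=
      mul_le_mul_of_nonneg_left (hgb (q z)) (gauge_nonneg _)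
    have h3 : ‖q z‖ * ‖q z‖ ≤ gauge K (p z) / ε * ‖q z‖ := by
      calc ‖q z‖ * ‖q z‖ = ‖q z‖ ^ 2 := (sq _).symm
        _ ≤ gauge K (p z) * (‖q z‖ / ε) := h1.trans h2
        _ = _ := by ring
    exact le_of_mul_le_mul_right h3 (norm_pos_iff.2 h)
  refine ⟨p, q, fun z => gauge K (p z), ⟨hadd, fun z => gauge_nonneg _, hself,
    fun z z' => by rw [mul_comm]; exact hle z' (p z),
    ⟨(max R 1 + 1 / ε)⁻¹, by positivity, fun z => ?_⟩,
    fun r z => (hsmul r z).1, fun r z => (hsmul r z).2,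
    fun r z => by rw [(hsmul r z).1, hgs]⟩, ?_⟩
  · rw [inv_mul_le_iff₀ (by positivity)]
    calc ‖z‖ = ‖p z + q z‖ := by rw [hadd]
      _ ≤ ‖p z‖ + ‖q z‖ := norm_add_le _ _
      _ ≤ max R 1 * gauge K (p z) + gauge K (p z) / ε := add_le_add (hpb _) (hqb z)
      _ = _ := by ring
  · ext w
    rw [mem_kPlus_iff hK]
    constructor
    · rintro ⟨h1, h2, h3⟩
      -- By uniqueness, a point of `K⁺` is the splitting of the sum of its components.
      have hsq := sq_sub_le_inner_sub (p := p (w.1 + w.2)) (q := q (w.1 + w.2)) (p' := w.1)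
        (q' := w.2) (s' := 1) (hself _) (by rw [h2, one_pow])
        (by rw [mul_one]; exact h3 _) (by simpa [h1] using hle (w.1 + w.2) w.1)
      obtain ⟨e1, e2⟩ := eq_of_add_eq_add_of_inner_nonneg (hadd (w.1 + w.2))
        ((sq_nonneg _).trans hsq)
      exact ⟨w.1 + w.2, by simp only [e1, h1], by rw [e1, e2]⟩
    · rintro ⟨z, hz, rfl⟩
      have hz' : gauge K (p z) = 1 := hz
      exact ⟨hz, by simp [hself, hz'], fun x => by simpa [hz'] using hle z x⟩

end PolarSplitting

/-! ### Lipschitz and gradient properties of the splitting -/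

namespace IsPolarSplitting

open scoped RealInnerProductSpace

variable {n : ℕ} {p q : VSpace n → VSpace n} {s : VSpace n → ℝ}

theorem sq_level_sub_le (h : IsPolarSplitting p q s) (z z' : VSpace n) :
    (s z - s z') ^ 2 ≤ ⟪p z - p z', q z - q z'⟫ :=
  sq_sub_le_inner_sub (h.inner_self z) (h.inner_self z') (h.abs_inner_le z z')
    (h.abs_inner_le z' z)

theorem sub_eq (h : IsPolarSplitting p q s) (z z' : VSpace n) :
    z - z' = (p z - p z') + (q z - q z') := by
  conv_lhs => rw [← h.add z, ← h.add z']
  abel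

theorem norm_sub_sq_eq (h : IsPolarSplitting p q s) (z z' : VSpace n) :
    ‖z - z'‖ ^ 2 = ‖p z - p z'‖ ^ 2 + 2 * ⟪p z - p z', q z - q z'⟫ + ‖q z - q z'‖ ^ 2 := by
  rw [h.sub_eq, norm_add_sq_real]

theorem lipschitz_of_sq_le {F : Type*} [NormedAddCommGroup F] {f : VSpace n → F}
    (hf : ∀ z z', ‖f z - f z'‖ ^ 2 ≤ ‖z - z'‖ ^ 2) : LipschitzWith 1 f := by
  refine LipschitzWith.of_dist_le_mul fun z z' => ?_
  rw [NNReal.coe_one, one_mul, dist_eq_norm, dist_eq_norm]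
  exact (sq_le_sq₀ (norm_nonneg _) (norm_nonneg _)).1 (hf z z')

theorem lipschitz_fst (h : IsPolarSplitting p q s) : LipschitzWith 1 p :=
  lipschitz_of_sq_le fun z z' => by
    nlinarith [h.norm_sub_sq_eq z z', h.sq_level_sub_le z z', sq_nonneg (s z - s z'),
      sq_nonneg ‖q z - q z'‖]

theorem lipschitz_snd (h : IsPolarSplitting p q s) : LipschitzWith 1 q :=
  lipschitz_of_sq_le fun z z' => by
    nlinarith [h.norm_sub_sq_eq z z', h.sq_level_sub_le z z', sq_nonneg (s z - s z'),
      sq_nonneg ‖p z - p z'‖]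

theorem lipschitz_level (h : IsPolarSplitting p q s) : LipschitzWith 1 s :=
  lipschitz_of_sq_le fun z z' => by
    rw [Real.norm_eq_abs, sq_abs]
    nlinarith [h.norm_sub_sq_eq z z', h.sq_level_sub_le z z', sq_nonneg (s z - s z'),
      sq_nonneg ‖p z - p z'‖, sq_nonneg ‖q z - q z'‖]

/-- The squared norms of the increments of `p + q` and `p - q` differ by four times a nonnegative
inner product. -/
theorem lipschitz_sub (h : IsPolarSplitting p q s) : LipschitzWith 1 fun z => p z - q z :=
  lipschitz_of_sq_le fun z z' => by
    have e : p z - q z - (p z' - q z') = (p z - p z') - (q z - q z') := by abel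
    rw [e, norm_sub_sq_real, h.norm_sub_sq_eq z z']
    nlinarith [h.sq_level_sub_le z z', sq_nonneg (s z - s z')]

theorem fst_zero (h : IsPolarSplitting p q s) : p 0 = 0 := by simpa using h.smul_fst 0 0

theorem snd_zero (h : IsPolarSplitting p q s) : q 0 = 0 := by simpa using h.smul_snd 0 0

theorem level_zero (h : IsPolarSplitting p q s) : s 0 = 0 := by simpa using h.smul_level 0 0

theorem level_smul_of_pos (h : IsPolarSplitting p q s) (r : ℝ) (hr : 0 < r) (z : VSpace n) :
    s (r • z) = r * s z := by rw [h.smul_level, abs_of_pos hr]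

theorem level_pos (h : IsPolarSplitting p q s) {z : VSpace n} (hz : z ≠ 0) : 0 < s z := by
  obtain ⟨c, hc, hcs⟩ := h.lower
  exact (mul_pos hc (norm_pos_iff.2 hz)).trans_le (hcs z)

/-- Although `p - q` is only nonexpansive in general, it contracts strictly towards `0`, because `‖p
z - q z‖ ^ 2 = ‖z‖ ^ 2 - 4 * s z ^ 2`. -/
theorem exists_norm_sub_le (h : IsPolarSplitting p q s) :
    ∃ κ : ℝ, 0 ≤ κ ∧ κ < 1 ∧ ∀ z, ‖p z - q z‖ ≤ κ * ‖z‖ := by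
  obtain ⟨c, hc, hcs⟩ := h.lower
  refine ⟨Real.sqrt (1 - 4 * c ^ 2), Real.sqrt_nonneg _, ?_, fun z => ?_⟩
  · rw [Real.sqrt_lt' one_pos]
    nlinarith [sq_pos_of_pos hc]
  · have h1 : ‖p z - q z‖ ^ 2 = ‖z‖ ^ 2 - 4 * s z ^ 2 := by
      have h2 := norm_add_sq_real (p z) (q z)
      rw [h.add] at h2
      rw [norm_sub_sq_real, h2, h.inner_self]
      ring
    have h3 : c ^ 2 * ‖z‖ ^ 2 ≤ s z ^ 2 := by
      rw [← mul_pow]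
      exact pow_le_pow_left₀ (by positivity) (hcs z) 2
    refine Real.le_sqrt_of_sq_le (y := (1 - 4 * c ^ 2) * ‖z‖ ^ 2) (by linarith) |>.trans ?_
    rw [Real.sqrt_mul' _ (sq_nonneg _), Real.sqrt_sq (norm_nonneg _)]

/-- `p` is the gradient of `⟨p z, z⟩ / 2`. -/
theorem hasFDerivAt_half_inner (h : IsPolarSplitting p q s) (z : VSpace n) :
    HasFDerivAt (fun z => ⟪p z, z⟫ / 2) (innerSL ℝ (p z)) z := by
  rw [hasFDerivAt_iff_isLittleO_nhds_zero]
  refine Asymptotics.IsBigO.trans_isLittleO (g := fun v : VSpace n => ‖v‖ ^ 2)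
    (Asymptotics.IsBigO.of_bound 3 (Filter.Eventually.of_forall fun v => ?_)) ?_
  · set z' := z + v
    have hv : v = (p z' - p z) + (q z' - q z) := by rw [← h.sub_eq]; simp [z']
    have h1 := h.norm_sub_sq_eq z' z
    have h2 := h.sq_level_sub_le z' z
    have e1 := h.inner_self z
    have e2 := h.inner_self z'
    have e3 := le_of_abs_le (h.abs_inner_le z z')
    have e4 := le_of_abs_le (h.abs_inner_le z' z)
    -- In this form the remainder is visibly nonnegative, and monotonicity bounds it by a multiple
    -- of `‖v‖ ^ 2`.
    have h3 : ⟪p z', z'⟫ / 2 - ⟪p z, z⟫ / 2 - innerSL ℝ (p z) v =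
        (‖p z' - p z‖ ^ 2 + (⟪p z', q z'⟫ + ⟪p z, q z⟫ - 2 * ⟪p z, q z'⟫)) / 2 := by
      have f1 : ⟪p z', z'⟫ = ⟪p z', p z'⟫ + ⟪p z', q z'⟫ := by rw [← inner_add_right, h.add]
      have f2 : ⟪p z, z⟫ = ⟪p z, p z⟫ + ⟪p z, q z⟫ := by rw [← inner_add_right, h.add]
      rw [innerSL_apply_apply, f1, f2, hv, norm_sub_sq_real, inner_add_right, inner_sub_right,
        inner_sub_right, real_inner_self_eq_norm_sq, real_inner_self_eq_norm_sq,
        real_inner_comm (p z') (p z)]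
      ring
    have hvn : ‖z' - z‖ = ‖v‖ := by simp [z']
    rw [hvn] at h1
    have h5 : ⟪p z' - p z, q z' - q z⟫ =
        ⟪p z', q z'⟫ - ⟪p z', q z⟫ - ⟪p z, q z'⟫ + ⟪p z, q z⟫ := by
      rw [inner_sub_left, inner_sub_right, inner_sub_right]
      ring
    rw [h3, Real.norm_of_nonneg, Real.norm_of_nonneg (sq_nonneg _)]
    · nlinarith [sq_nonneg (s z' - s z), sq_nonneg ‖q z' - q z‖, sq_nonneg ‖p z' - p z‖]
    · nlinarith [sq_nonneg (s z' - s z), sq_nonneg ‖p z' - p z‖]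
  · simpa using Asymptotics.isLittleO_norm_pow_id one_lt_two

/-- As `p` is a gradient, its derivative is a second derivative, hence symmetric. -/
theorem fderiv_fst_symm (h : IsPolarSplitting p q s) {z : VSpace n}
    (hz : DifferentiableAt ℝ p z) (v w : VSpace n) :
    ⟪fderiv ℝ p z v, w⟫ = ⟪fderiv ℝ p z w, v⟫ := by
  have h1 : HasFDerivAt (fun z => innerSL ℝ (p z)) ((innerSL ℝ).comp (fderiv ℝ p z)) z :=
    (innerSL ℝ (E := VSpace n)).hasFDerivAt.comp z hz.hasFDerivAt
  have h2 := second_derivative_symmetric (𝕜 := ℝ) h.hasFDerivAt_half_inner h1 v w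
  simpa using h2

end IsPolarSplitting

/-! ### Parametrizing `W` by the two cones -/

section JoinParametrization

open scoped RealInnerProductSpace

variable {n : ℕ}

/-- Swapped reflections: the perturbation of the identity in diagonal coordinates on `W`. -/
def crossReflection (p q : VSpace n → VSpace n) (ζ : WSpace n) : WSpace n :=
  (p ζ.2 - q ζ.2, p ζ.1 - q ζ.1)

/-- The sum of a point of the cone over `K⁺` and a point of the cone over `K⁻`. -/
def joinMap (p q : VSpace n → VSpace n) (ζ : WSpace n) : WSpace n :=
  (p ζ.1 + p ζ.2, q ζ.1 - q ζ.2)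

/-- The passage from diagonal coordinates to the coordinates of `V × V*`. -/
noncomputable def diagonalEquiv (n : ℕ) : WSpace n ≃L[ℝ] WSpace n :=
  LinearEquiv.toContinuousLinearEquiv
    { toFun := fun w => ((2⁻¹ : ℝ) • (w.1 + w.2), (2⁻¹ : ℝ) • (w.1 - w.2))
      invFun := fun w => (w.1 + w.2, w.1 - w.2)
      map_add' := fun v w => by ext1 <;> simp only [Prod.fst_add, Prod.snd_add] <;> module
      map_smul' := fun r w => by
        ext1 <;> simp only [Prod.smul_fst, Prod.smul_snd, RingHom.id_apply] <;> module
      left_inv := fun w => by ext1 <;> simp only <;> module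
      right_inv := fun w => by ext1 <;> simp only <;> module }

theorem diagonalEquiv_apply (w : WSpace n) :
    diagonalEquiv n w = ((2⁻¹ : ℝ) • (w.1 + w.2), (2⁻¹ : ℝ) • (w.1 - w.2)) := rfl

namespace IsPolarSplitting

variable {p q : VSpace n → VSpace n} {s : VSpace n → ℝ}

theorem joinMap_eq (h : IsPolarSplitting p q s) (ζ : WSpace n) :
    joinMap p q ζ = diagonalEquiv n (ζ + crossReflection p q ζ) := by
  have h1 := h.add ζ.1
  have h2 := h.add ζ.2
  rw [diagonalEquiv_apply]
  ext1
  · simp only [joinMap, crossReflection, Prod.fst_add, Prod.snd_add]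
    linear_combination (norm := module) (2⁻¹ : ℝ) • h1 + (2⁻¹ : ℝ) • h2
  · simp only [joinMap, crossReflection, Prod.fst_add, Prod.snd_add]
    linear_combination (norm := module) (2⁻¹ : ℝ) • h1 - (2⁻¹ : ℝ) • h2

theorem lipschitz_crossReflection (h : IsPolarSplitting p q s) :
    LipschitzWith 1 (crossReflection p q) := by
  have h1 := (h.lipschitz_sub.comp LipschitzWith.prod_snd).prodMk
    (h.lipschitz_sub.comp LipschitzWith.prod_fst)
  rwa [show max ((1 : NNReal) * 1) (1 * 1) = 1 by simp] at h1

/-- The larger component of `ζ` is perturbed by the reflection of the smaller one, which is shorter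
by a factor `κ < 1`. Uniformity in `t` serves the limit `t → 1`. -/
theorem crossReflection_lower_bound (h : IsPolarSplitting p q s) :
    ∃ c, 0 < c ∧ ∀ t : ℝ, 0 ≤ t → t ≤ 1 → ∀ ζ,
      c * ‖ζ‖ ≤ ‖ζ + t • crossReflection p q ζ‖ := by
  obtain ⟨κ, hκ0, hκ1, hκ⟩ := h.exists_norm_sub_le
  refine ⟨1 - κ, sub_pos.2 hκ1, fun t ht0 ht1 ζ => ?_⟩
  have key : ∀ x y g : VSpace n, ‖g‖ ≤ κ * ‖y‖ → ‖y‖ ≤ ‖x‖ → (1 - κ) * ‖x‖ ≤ ‖x + t • g‖ := by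
    intro x y g hg hxy
    have h1 : ‖t • g‖ ≤ κ * ‖x‖ := by
      rw [norm_smul, Real.norm_of_nonneg ht0]
      exact (mul_le_of_le_one_left (norm_nonneg _) ht1).trans
        (hg.trans (mul_le_mul_of_nonneg_left hxy hκ0))
    have h2 := norm_sub_le (x + t • g) (t • g)
    rw [add_sub_cancel_right] at h2
    linarith
  rcases le_total ‖ζ.1‖ ‖ζ.2‖ with hle | hle
  · rw [Prod.norm_def ζ, max_eq_right hle]
    exact (key _ _ _ (hκ ζ.1) hle).trans (norm_snd_le (ζ + t • crossReflection p q ζ))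
  · rw [Prod.norm_def ζ, max_eq_left hle]
    exact (key _ _ _ (hκ ζ.2) hle).trans (norm_fst_le (ζ + t • crossReflection p q ζ))

theorem isProperMap_add_crossReflection (h : IsPolarSplitting p q s) :
    IsProperMap fun ζ => ζ + crossReflection p q ζ := by
  obtain ⟨c, hc, hcb⟩ := h.crossReflection_lower_bound
  have hcont := h.lipschitz_crossReflection.continuous
  rw [isProperMap_iff_tendsto_cocompact]
  refine ⟨by fun_prop, ?_⟩
  rw [← cobounded_eq_cocompact, ← tendsto_norm_atTop_iff_cobounded]
  refine Filter.tendsto_atTop_mono (fun ζ => by simpa using hcb 1 zero_le_one le_rfl ζ)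
    (Filter.Tendsto.const_mul_atTop hc tendsto_norm_cobounded_atTop)

theorem lipschitz_smul_crossReflection (h : IsPolarSplitting p q s) (t : NNReal) :
    LipschitzWith t fun ζ => (t : ℝ) • crossReflection p q ζ := by
  have := (lipschitzWith_smul (t : ℝ)).comp h.lipschitz_crossReflection
  rwa [show ‖(t : ℝ)‖₊ * 1 = t by simp] at this

/-- The perturbation has Lipschitz constant exactly `1`, out of reach of the fixed point argument.
Damping it by `1 - δ` gives approximate solutions, and the range is closed by properness. -/
theorem surjective_add_crossReflection (h : IsPolarSplitting p q s) :
    Function.Surjective fun ζ => ζ + crossReflection p q ζ := by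
  obtain ⟨c, hc, hcb⟩ := h.crossReflection_lower_bound
  intro w
  have hclosed := h.isProperMap_add_crossReflection.isClosedMap.isClosed_range
  change w ∈ range _
  rw [← hclosed.closure_eq, Metric.mem_closure_range_iff]
  intro ε hε
  -- The error is at most `δ * ‖ζ‖ ≤ δ * ‖w‖ / c`, which this choice keeps below `ε`.
  set δ : ℝ := min 1 (ε * c / (2 * (‖w‖ + 1)))
  have hw : 0 < ‖w‖ + 1 := by positivity
  have hδ0 : 0 < δ := lt_min one_pos (by positivity)
  have hδ1 : δ ≤ 1 := min_le_left _ _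
  have ht : ((1 - δ).toNNReal : ℝ) = 1 - δ := Real.coe_toNNReal _ (by linarith)
  obtain ⟨ζ, hζ⟩ := (bijective_add_of_lipschitz
    (h.lipschitz_smul_crossReflection (1 - δ).toNNReal) (by
      rw [← NNReal.coe_lt_coe, ht, NNReal.coe_one]; linarith)).surjective w
  simp only [ht] at hζ
  refine ⟨ζ, ?_⟩
  have h1 := hcb (1 - δ) (by linarith) (by linarith) ζ
  rw [hζ] at h1
  have h2 : ‖crossReflection p q ζ‖ ≤ ‖ζ‖ := by
    have h3 := h.lipschitz_crossReflection.dist_le_mul ζ 0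
    have h4 : crossReflection p q 0 = 0 := by
      simp [crossReflection, h.fst_zero, h.snd_zero]
    simpa [h4] using h3
  have h5 : w - (ζ + crossReflection p q ζ) = -(δ • crossReflection p q ζ) := by
    rw [← hζ, sub_smul, one_smul]
    abel
  rw [dist_eq_norm, h5, norm_neg, norm_smul, Real.norm_of_nonneg hδ0.le]
  have h6 : δ * (2 * (‖w‖ + 1)) ≤ ε * c := by
    rw [← le_div_iff₀ (by positivity)]
    exact min_le_right _ _
  have h7 : δ * ‖crossReflection p q ζ‖ * c ≤ δ * ‖w‖ := by
    calc δ * ‖crossReflection p q ζ‖ * c ≤ δ * (c * ‖ζ‖) := by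
          rw [mul_assoc, mul_comm _ c]; gcongr
      _ ≤ _ := by gcongr
  have h8 : δ * ‖crossReflection p q ζ‖ * c < ε * c := by
    have : 0 ≤ δ * ‖w‖ := by positivity
    nlinarith
  exact lt_of_mul_lt_mul_right h8 hc.le

/-- Equal images make the two monotonicity products opposite. Each dominates a square, so both
squares vanish. This replaces injectivity of `joinMap`. -/
theorem level_eq_of_joinMap_eq (h : IsPolarSplitting p q s) {ζ ζ' : WSpace n}
    (he : joinMap p q ζ = joinMap p q ζ') : s ζ.1 = s ζ'.1 ∧ s ζ.2 = s ζ'.2 := by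
  have e1 : p ζ.1 - p ζ'.1 = -(p ζ.2 - p ζ'.2) := by
    have : p ζ.1 + p ζ.2 = p ζ'.1 + p ζ'.2 := congrArg Prod.fst he
    rw [neg_sub, sub_eq_sub_iff_add_eq_add, this, add_comm]
  have e2 : q ζ.1 - q ζ'.1 = q ζ.2 - q ζ'.2 := by
    have : q ζ.1 - q ζ.2 = q ζ'.1 - q ζ'.2 := congrArg Prod.snd he
    rw [sub_eq_sub_iff_add_eq_add] at this ⊢
    rw [this, add_comm]
  have h1 := h.sq_level_sub_le ζ.1 ζ'.1
  have h2 := h.sq_level_sub_le ζ.2 ζ'.2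
  rw [e1, e2, inner_neg_left] at h1
  have h3 : (s ζ.1 - s ζ'.1) ^ 2 = 0 := by
    nlinarith [sq_nonneg (s ζ.1 - s ζ'.1), sq_nonneg (s ζ.2 - s ζ'.2)]
  have h4 : (s ζ.2 - s ζ'.2) ^ 2 = 0 := by
    nlinarith [sq_nonneg (s ζ.1 - s ζ'.1), sq_nonneg (s ζ.2 - s ζ'.2)]
  exact ⟨sub_eq_zero.1 (pow_eq_zero_iff two_ne_zero |>.1 h3),
    sub_eq_zero.1 (pow_eq_zero_iff two_ne_zero |>.1 h4)⟩

theorem isQuotientMap_joinMap (h : IsPolarSplitting p q s) :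
    Topology.IsQuotientMap (joinMap p q) := by
  have h1 : joinMap p q = diagonalEquiv n ∘ fun ζ => ζ + crossReflection p q ζ :=
    funext h.joinMap_eq
  rw [h1]
  exact (diagonalEquiv n).toHomeomorph.isQuotientMap.comp
    (h.isProperMap_add_crossReflection.isClosedMap.isQuotientMap
      h.isProperMap_add_crossReflection.continuous h.surjective_add_crossReflection)

theorem joinMap_smul (h : IsPolarSplitting p q s) (r : ℝ) (ζ : WSpace n) :
    joinMap p q (r • ζ) = r • joinMap p q ζ := by
  simp only [joinMap, Prod.smul_fst, Prod.smul_snd, h.smul_fst, h.smul_snd, Prod.smul_mk,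
    smul_add, smul_sub]

/-- The homogeneous function on `W` whose unit level set is the join of `K⁺` and `K⁻`. -/
theorem exists_joinNorm (h : IsPolarSplitting p q s) :
    ∃ N : WSpace n → ℝ, Continuous N ∧ (∀ ζ, N (joinMap p q ζ) = s ζ.1 + s ζ.2) ∧
      (∀ r : ℝ, 0 < r → ∀ w, N (r • w) = r * N w) ∧ ∃ c, 0 < c ∧ ∀ w, c * ‖w‖ ≤ N w := by
  have hsurj := h.isQuotientMap_joinMap.surjective
  set N : WSpace n → ℝ := fun w =>
    s (Function.surjInv hsurj w).1 + s (Function.surjInv hsurj w).2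
  have hN : ∀ ζ, N (joinMap p q ζ) = s ζ.1 + s ζ.2 := fun ζ => by
    obtain ⟨h1, h2⟩ := h.level_eq_of_joinMap_eq (Function.surjInv_eq hsurj (joinMap p q ζ))
    simp only [N, h1, h2]
  refine ⟨N, ?_, hN, fun r hr w => ?_, ?_⟩
  · rw [h.isQuotientMap_joinMap.continuous_iff]
    have : N ∘ joinMap p q = fun ζ => s ζ.1 + s ζ.2 := funext hN
    rw [this]
    have := h.lipschitz_level.continuous
    fun_prop
  · obtain ⟨ζ, rfl⟩ := hsurj w
    rw [← h.joinMap_smul, hN, hN, Prod.smul_fst, Prod.smul_snd, h.level_smul_of_pos r hr,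
      h.level_smul_of_pos r hr, mul_add]
  · obtain ⟨c, hc, hcs⟩ := h.lower
    refine ⟨c / 2, by positivity, fun w => ?_⟩
    obtain ⟨ζ, rfl⟩ := hsurj w
    rw [hN]
    have hp : ∀ z, ‖p z‖ ≤ ‖z‖ := fun z => by
      simpa [h.fst_zero] using h.lipschitz_fst.dist_le_mul z 0
    have hq : ∀ z, ‖q z‖ ≤ ‖z‖ := fun z => by
      simpa [h.snd_zero] using h.lipschitz_snd.dist_le_mul z 0
    have h1 : ‖joinMap p q ζ‖ ≤ ‖ζ.1‖ + ‖ζ.2‖ := by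
      refine max_le ?_ ?_
      · exact (norm_add_le _ _).trans (add_le_add (hp _) (hp _))
      · exact (norm_sub_le _ _).trans (add_le_add (hq _) (hq _))
    have h2 := mul_le_mul_of_nonneg_left h1 hc.le
    nlinarith [hcs ζ.1, hcs ζ.2, h.nonneg ζ.1, h.nonneg ζ.2, norm_nonneg (joinMap p q ζ)]

end IsPolarSplitting

end JoinParametrization

/-! ### The heart as a sublevel set, and its comparison with the diamond -/

section Heart

open scoped RealInnerProductSpace

variable {n : ℕ}

/-- The region enclosed by the unit level set of a positively homogeneous function. -/
theorem enclosedRegion_level {N : WSpace n → ℝ} (hN : Continuous N)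
    (hhom : ∀ r : ℝ, 0 < r → ∀ w, N (r • w) = r * N w) {c : ℝ} (hc : 0 < c)
    (hcN : ∀ w, c * ‖w‖ ≤ N w) : enclosedRegion {w | N w = 1} = {w | N w ≤ 1} := by
  have hcompl : {w | N w = 1}ᶜ = {w | N w < 1} ∪ {w | 1 < N w} := by
    ext w
    exact ne_iff_lt_or_gt
  have hlt : IsOpen {w | N w < 1} := isOpen_lt hN continuous_const
  have hgt : IsOpen {w | 1 < N w} := isOpen_lt continuous_const hN
  have hdisj : Disjoint {w | N w < 1} {w | 1 < N w} :=
    disjoint_left.2 fun w h1 h2 => lt_asymm (a := N w) h1 h2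
  ext w
  constructor
  · rintro (hw | ⟨hw, hbd⟩)
    · exact le_of_eq hw
    · by_contra hgt1
      have hgt1 : 1 < N w := not_le.1 hgt1
      -- The outward ray from `w` avoids the level set and is unbounded.
      have hray : IsPreconnected ((fun r : ℝ => r • w) '' Ici 1) :=
        isPreconnected_Ici.image _ (by fun_prop)
      have hsub := hray.subset_connectedComponentIn (F := {w | N w = 1}ᶜ) (x := w)
        ⟨1, mem_Ici.2 le_rfl, one_smul ℝ w⟩ (by
          rintro _ ⟨r, hr, rfl⟩
          have hr : 1 ≤ r := hr
          have : 1 < N (r • w) := by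
            rw [hhom r (by linarith)]
            nlinarith
          exact this.ne')
      obtain ⟨R, hR⟩ := (hbd.subset hsub).exists_norm_le
      have hw0 : w ≠ 0 := by
        rintro rfl
        have := hhom 2 two_pos 0
        rw [smul_zero] at this
        linarith
      have hwn : 0 < ‖w‖ := norm_pos_iff.2 hw0
      have h1 := hR _ ⟨max 1 ((R + 1) / ‖w‖), mem_Ici.2 (le_max_left _ _), rfl⟩
      simp only [norm_smul, Real.norm_eq_abs] at h1
      have h2 : R + 1 ≤ |max 1 ((R + 1) / ‖w‖)| * ‖w‖ := by
        rw [← div_le_iff₀ hwn]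
        exact (le_max_right _ _).trans (le_abs_self _)
      linarith
  · intro hw
    rcases eq_or_lt_of_le (show N w ≤ 1 from hw) with h | h
    · exact Or.inl h
    · refine Or.inr ⟨h.ne, ?_⟩
      have hsub : connectedComponentIn {w | N w = 1}ᶜ w ⊆ {w | N w < 1} :=
        isPreconnected_connectedComponentIn.subset_left_of_subset_union hlt hgt hdisj
          (hcompl ▸ connectedComponentIn_subset _ _) ⟨w, mem_connectedComponentIn h.ne, h⟩
      refine (isBounded_closedBall (x := (0 : WSpace n)) (r := 1 / c)).subset
        (hsub.trans fun v hv => ?_)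
      rw [mem_closedBall_zero_iff, le_div_iff₀ hc, mul_comm]
      exact (hcN v).trans (le_of_lt hv)

theorem mem_kMinus_iff {K : Set (VSpace n)} {w : WSpace n} :
    w ∈ kMinus K ↔ (w.1, -w.2) ∈ kPlus K := by
  simp only [kMinus, kPlus, polarBody, mem_ofPred_eq, inner_neg_right, mem_Icc]
  refine and_congr_right fun _ => and_congr (forall₂_congr fun x _ => ?_) ?_
  · constructor <;> rintro ⟨h1, h2⟩ <;> constructor <;> linarith
  · constructor <;> intro h <;> linarith

namespace IsPolarSplitting

variable {p q : VSpace n → VSpace n} {s : VSpace n → ℝ} {K : Set (VSpace n)}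

/-- For `z = 0` any point of the level set serves; one exists because `n ≠ 0`. -/
theorem exists_eq_smul [NeZero n] (h : IsPolarSplitting p q s) (z : VSpace n) :
    ∃ z', s z' = 1 ∧ z = s z • z' := by
  have key : ∀ z, z ≠ 0 → s ((s z)⁻¹ • z) = 1 ∧ z = s z • (s z)⁻¹ • z := fun z hz => by
    have hs := h.level_pos hz
    rw [h.level_smul_of_pos _ (inv_pos.2 hs), inv_mul_cancel₀ hs.ne', smul_smul,
      mul_inv_cancel₀ hs.ne', one_smul]
    exact ⟨rfl, rfl⟩
  by_cases hz : z = 0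
  · obtain ⟨z₁, hz₁⟩ := exists_ne (0 : VSpace n)
    exact ⟨_, (key z₁ hz₁).1, by rw [hz, h.level_zero, zero_smul]⟩
  · exact ⟨_, key z hz⟩

/-- The weights of a segment are absorbed by homogeneity: a point with weights `α`, `β` is the image
of `(α z, β z')`, at level `α + β`. -/
theorem convexJoin_eq [NeZero n] (h : IsPolarSplitting p q s)
    (hK : kPlus K = {w | ∃ z, s z = 1 ∧ w = (p z, q z)}) {N : WSpace n → ℝ}
    (hN : ∀ ζ, N (joinMap p q ζ) = s ζ.1 + s ζ.2) :
    convexJoin ℝ (kPlus K) (kMinus K) = {w | N w = 1} := by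
  ext w
  rw [mem_convexJoin]
  constructor
  · rintro ⟨a, ha, b, hb, α, β, hα, hβ, hαβ, rfl⟩
    rw [mem_kMinus_iff] at hb
    rw [hK] at ha hb
    obtain ⟨z, hz, rfl⟩ := ha
    obtain ⟨z', hz', hb⟩ := hb
    have hb' : b = (p z', -q z') := by
      have h1 := congrArg Prod.fst hb
      have h2 := congrArg Prod.snd hb
      exact Prod.ext h1 (by simp only at h2 ⊢; rw [← h2, neg_neg])
    have e : α • (p z, q z) + β • b = joinMap p q (α • z, β • z') := by
      rw [hb']
      simp only [joinMap, h.smul_fst, h.smul_snd, Prod.smul_mk, Prod.mk_add_mk, smul_neg,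
        sub_eq_add_neg]
    change N _ = 1
    rw [e, hN]
    simp only [h.smul_level, hz, hz', abs_of_nonneg hα, abs_of_nonneg hβ, mul_one, hαβ]
  · intro hw
    obtain ⟨ζ, rfl⟩ := h.isQuotientMap_joinMap.surjective w
    have hw : s ζ.1 + s ζ.2 = 1 := by rw [← hN]; exact hw
    obtain ⟨z, hz, e1⟩ := h.exists_eq_smul ζ.1
    obtain ⟨z', hz', e2⟩ := h.exists_eq_smul ζ.2
    refine ⟨(p z, q z), hK ▸ ⟨z, hz, rfl⟩, (p z', -q z'), ?_, s ζ.1, s ζ.2, h.nonneg _, h.nonneg _,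
      hw, ?_⟩
    · rw [mem_kMinus_iff, hK]
      exact ⟨z', hz', by simp only [neg_neg]⟩
    · have e3 : joinMap p q ζ = joinMap p q (s ζ.1 • z, s ζ.2 • z') := by rw [← e1, ← e2]
      rw [e3]
      simp only [joinMap, h.smul_fst, h.smul_snd, Prod.smul_mk, Prod.mk_add_mk, smul_neg,
        sub_eq_add_neg]

theorem exists_joinNorm_kHeart [NeZero n] (h : IsPolarSplitting p q s)
    (hK : kPlus K = {w | ∃ z, s z = 1 ∧ w = (p z, q z)}) :
    ∃ N : WSpace n → ℝ, Continuous N ∧ (∀ ζ, N (joinMap p q ζ) = s ζ.1 + s ζ.2) ∧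
      (∀ r : ℝ, 0 < r → ∀ w, N (r • w) = r * N w) ∧ (∃ c, 0 < c ∧ ∀ w, c * ‖w‖ ≤ N w) ∧
      convexJoin ℝ (kPlus K) (kMinus K) = {w | N w = 1} ∧ kHeart K = {w | N w ≤ 1} := by
  obtain ⟨N, hcont, hN, hhom, c, hc, hcN⟩ := h.exists_joinNorm
  have hj := h.convexJoin_eq hK hN
  exact ⟨N, hcont, hN, hhom, ⟨c, hc, hcN⟩, hj,
    by rw [kHeart, hj, enclosedRegion_level hcont hhom hc hcN]⟩

/-- Every nonzero point of the heart lies between `0`, the midpoint of two antipodes of `K⁺`, and a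
point of the join. -/
theorem kHeart_subset_kDiamond [NeZero n] (h : IsPolarSplitting p q s)
    (hK : kPlus K = {w | ∃ z, s z = 1 ∧ w = (p z, q z)}) : kHeart K ⊆ kDiamond K := by
  obtain ⟨N, -, hN, hhom, ⟨c, hc, hcN⟩, hj, hheart⟩ := h.exists_joinNorm_kHeart hK
  have hconv : Convex ℝ (kDiamond K) := convex_convexHull ℝ _
  have hsub : kPlus K ⊆ kDiamond K := subset_union_left.trans (subset_convexHull ℝ _)
  have hsub' : kMinus K ⊆ kDiamond K := subset_union_right.trans (subset_convexHull ℝ _)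
  have h0 : (0 : WSpace n) ∈ kDiamond K := by
    obtain ⟨z, hz, -⟩ := h.exists_eq_smul 0
    have hm : ∀ z, s z = 1 → (p z, q z) ∈ kDiamond K := fun z hz => hsub (hK ▸ ⟨z, hz, rfl⟩)
    have h1 := hconv (hm z hz) (hm ((-1 : ℝ) • z) (by rw [h.smul_level]; simp [hz]))
      one_half_pos.le one_half_pos.le (by norm_num)
    convert h1 using 1
    rw [h.smul_fst, h.smul_snd, ← Prod.smul_mk]
    module
  rw [hheart]
  intro w hw
  by_cases hw0 : w = 0
  · rwa [hw0]
  have hpos : 0 < N w := (mul_pos hc (norm_pos_iff.2 hw0)).trans_le (hcN w)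
  have h1 : (N w)⁻¹ • w ∈ convexJoin ℝ (kPlus K) (kMinus K) := by
    rw [hj, mem_ofPred_eq, hhom _ (inv_pos.2 hpos), inv_mul_cancel₀ hpos.ne']
  obtain ⟨a, ha, b, hb, hseg⟩ := mem_convexJoin.1 h1
  have h2 := hconv.segment_subset (hsub ha) (hsub' hb) hseg
  have h3 := hconv.smul_mem_of_zero_mem h0 h2 ⟨hpos.le, hw⟩
  rwa [smul_smul, mul_inv_cancel₀ hpos.ne', one_smul] at h3

end IsPolarSplitting

theorem IsEllipsoid.isSymmetricConvexBody {K : Set (VSpace n)} (hK : IsEllipsoid K) :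
    IsSymmetricConvexBody K := by
  obtain ⟨A, rfl⟩ := hK
  have hA : Continuous A := A.toLinearMap.continuous_of_finiteDimensional
  refine ⟨(isCompact_closedBall 0 1).image hA, ?_, ?_, ?_⟩
  · exact (convex_closedBall (0 : VSpace n) 1).linear_image A.toLinearMap
  · refine ⟨0, ?_⟩
    rw [mem_interior_iff_mem_nhds]
    have h := A.toContinuousLinearEquiv.toHomeomorph.isOpenMap.image_mem_nhds
      (closedBall_mem_nhds (0 : VSpace n) one_pos)
    convert h using 1
    · simp
    · rfl
  · rintro _ ⟨x, hx, rfl⟩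
    exact ⟨-x, by simpa using hx, map_neg A x⟩

/-- For `K = A B`, with `B` the unit ball, `K⁺` consists of the pairs with `A⁻¹ x = Aᵀ y` a unit
vector. Then `N` is half the sum of the norms of `A⁻¹ x ± Aᵀ y`, a convex function. -/
theorem IsEllipsoid.kHeart_eq_kDiamond [NeZero n] {K : Set (VSpace n)} (hE : IsEllipsoid K)
    {p q : VSpace n → VSpace n} {s : VSpace n → ℝ} (h : IsPolarSplitting p q s)
    (hK : kPlus K = {w | ∃ z, s z = 1 ∧ w = (p z, q z)}) : kHeart K = kDiamond K := by
  refine (h.kHeart_subset_kDiamond hK).antisymm ?_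
  obtain ⟨N, -, hN, -, -, hj, hheart⟩ := h.exists_joinNorm_kHeart hK
  obtain ⟨A, rfl⟩ := hE
  set T : VSpace n →ₗ[ℝ] VSpace n := LinearMap.adjoint A.toLinearMap
  -- The equality case of Cauchy–Schwarz.
  have hunit : ∀ z, s z = 1 → A.symm (p z) = T (q z) ∧ ‖T (q z)‖ = 1 := by
    intro z hz
    have hmem : (p z, q z) ∈ kPlus (A '' closedBall 0 1) := hK ▸ ⟨z, hz, rfl⟩
    obtain ⟨⟨v, hv, hvp⟩, hpol, hin⟩ := hmem
    have hv1 : ‖v‖ ≤ 1 := by simpa using hv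
    have hT : ∀ u, ⟪A u, q z⟫ = ⟪u, T (q z)⟫ := fun u =>
      (LinearMap.adjoint_inner_right A.toLinearMap u (q z)).symm
    simp only at hvp hin
    rw [← hvp, hT] at hin
    have hge : 1 ≤ ‖T (q z)‖ := by
      have h1 := real_inner_le_norm v (T (q z))
      rw [hin] at h1
      exact h1.trans (mul_le_of_le_one_left (norm_nonneg _) hv1)
    have hle : ‖T (q z)‖ ≤ 1 := by
      have hpos : 0 < ‖T (q z)‖ := one_pos.trans_le hge
      have h1 := (hpol (A (‖T (q z)‖⁻¹ • T (q z))) ⟨_, by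
        simp [norm_smul, hpos.ne'], rfl⟩).2
      rwa [hT, real_inner_smul_left, real_inner_self_eq_norm_sq, sq, ← mul_assoc,
        inv_mul_cancel₀ hpos.ne', one_mul] at h1
    have hnorm := le_antisymm hle hge
    refine ⟨?_, hnorm⟩
    rw [← hvp, LinearEquiv.symm_apply_apply, ← sub_eq_zero, ← norm_eq_zero]
    have h2 := norm_sub_sq_real v (T (q z))
    rw [hin, hnorm] at h2
    nlinarith [norm_nonneg (v - T (q z)), norm_nonneg v]
  have hall : ∀ z, A.symm (p z) = T (q z) ∧ ‖T (q z)‖ = s z := by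
    intro z
    obtain ⟨z', hz', e⟩ := h.exists_eq_smul z
    obtain ⟨h1, h2⟩ := hunit z' hz'
    rw [e, h.smul_fst, h.smul_snd, map_smul, map_smul, h1, norm_smul, h2, h.smul_level, hz',
      Real.norm_eq_abs]
    exact ⟨rfl, rfl⟩
  have hNeq : ∀ w, N w = (‖A.symm w.1 + T w.2‖ + ‖A.symm w.1 - T w.2‖) / 2 := by
    intro w
    obtain ⟨ζ, rfl⟩ := h.isQuotientMap_joinMap.surjective w
    rw [hN]
    have e1 : A.symm (joinMap p q ζ).1 + T (joinMap p q ζ).2 = (2 : ℝ) • T (q ζ.1) := by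
      simp only [joinMap, map_add, map_sub, (hall ζ.1).1, (hall ζ.2).1]
      module
    have e2 : A.symm (joinMap p q ζ).1 - T (joinMap p q ζ).2 = (2 : ℝ) • T (q ζ.2) := by
      simp only [joinMap, map_add, map_sub, (hall ζ.1).1, (hall ζ.2).1]
      module
    rw [e1, e2, norm_smul, norm_smul, (hall ζ.1).2, (hall ζ.2).2, Real.norm_two]
    ring
  refine convexHull_min ?_ ?_
  · rw [hheart]
    refine (union_subset_iff.2 ⟨?_, ?_⟩).trans ((le_of_eq hj).trans fun w hw => le_of_eq hw)
    · intro a ha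
      obtain ⟨z, hz, -⟩ := h.exists_eq_smul 0
      exact mem_convexJoin.2 ⟨a, ha, (p z, -q z), mem_kMinus_iff.2 (by
        rw [hK]; exact ⟨z, hz, by simp only [neg_neg]⟩), left_mem_segment ℝ _ _⟩
    · intro b hb
      obtain ⟨z, hz, -⟩ := h.exists_eq_smul 0
      exact mem_convexJoin.2 ⟨(p z, q z), hK ▸ ⟨z, hz, rfl⟩, b, hb, right_mem_segment ℝ _ _⟩
  · rw [hheart]
    intro w hw w' hw' a b ha hb hab
    have hw : N w ≤ 1 := hw
    have hw' : N w' ≤ 1 := hw'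
    change N _ ≤ 1
    rw [hNeq] at hw hw' ⊢
    have e1 : A.symm (a • w + b • w').1 + T (a • w + b • w').2 =
        a • (A.symm w.1 + T w.2) + b • (A.symm w'.1 + T w'.2) := by
      simp only [Prod.fst_add, Prod.snd_add, Prod.smul_fst, Prod.smul_snd, map_add, map_smul]
      module
    have e2 : A.symm (a • w + b • w').1 - T (a • w + b • w').2 =
        a • (A.symm w.1 - T w.2) + b • (A.symm w'.1 - T w'.2) := by
      simp only [Prod.fst_add, Prod.snd_add, Prod.smul_fst, Prod.smul_snd, map_add, map_smul]
      module
    have key : ∀ x y : VSpace n, ‖a • x + b • y‖ ≤ a * ‖x‖ + b * ‖y‖ := fun x y => by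
      refine (norm_add_le _ _).trans ?_
      rw [norm_smul, norm_smul, Real.norm_of_nonneg ha, Real.norm_of_nonneg hb]
    rw [e1, e2]
    have k1 := key (A.symm w.1 + T w.2) (A.symm w'.1 + T w'.2)
    have k2 := key (A.symm w.1 - T w.2) (A.symm w'.1 - T w'.2)
    nlinarith [mul_le_mul_of_nonneg_left hw ha, mul_le_mul_of_nonneg_left hw' hb]

end Heart

/-! ### The Jacobian as a pairing of tangent `n`-vectors -/

section ConeTangent

open scoped RealInnerProductSpace

variable {n : ℕ}

theorem det_id_add_swap (M N : VSpace n →L[ℝ] VSpace n) :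
    (ContinuousLinearMap.id ℝ (WSpace n) +
      (M.comp (ContinuousLinearMap.snd ℝ (VSpace n) (VSpace n))).prod
        (N.comp (ContinuousLinearMap.fst ℝ (VSpace n) (VSpace n)))).det =
      (1 - Matrix.of (fun i j => N (EuclideanSpace.single j 1) i) *
        Matrix.of (fun i j => M (EuclideanSpace.single j 1) i)).det := by
  set b := (EuclideanSpace.basisFun (Fin n) ℝ).toBasis
  rw [ContinuousLinearMap.det, ← LinearMap.det_toMatrix (b.prod b)]
  rw [← Matrix.det_fromBlocks_one₁₁]
  congr 1
  ext i j
  rcases i with i | i <;> rcases j with j | j <;>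
    simp [LinearMap.toMatrix_apply, b, Matrix.one_apply]

/-- The square of the map is half the identity on a space of dimension `2n`. -/
theorem abs_det_diagonalEquiv :
    |(diagonalEquiv n : WSpace n →L[ℝ] WSpace n).det| = (2⁻¹ : ℝ) ^ n := by
  set D : WSpace n →ₗ[ℝ] WSpace n := 
    (diagonalEquiv n : WSpace n →L[ℝ] WSpace n).toLinearMap
  have h1 : D ∘ₗ D = (2⁻¹ : ℝ) • LinearMap.id := by
    refine LinearMap.ext fun w => ?_
    change diagonalEquiv n (diagonalEquiv n w) = (2⁻¹ : ℝ) • w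
    rw [diagonalEquiv_apply, diagonalEquiv_apply]
    ext1 <;> simp only [Prod.smul_fst, Prod.smul_snd] <;> module
  have h2 := congrArg LinearMap.det h1
  rw [LinearMap.det_comp, LinearMap.det_smul, LinearMap.det_id, mul_one, Module.finrank_prod,
    finrank_euclideanSpace_fin, pow_add] at h2
  change |LinearMap.det D| = _
  rw [← abs_of_pos (by positivity : (0 : ℝ) < (2⁻¹) ^ n)]
  exact abs_eq_abs.2 (mul_self_eq_mul_self_iff.1 h2)

/-- The tangent `n`-vector of the cone over `K⁺` at the point `(p z, q z)`. -/
noncomputable def coneTangent (p q : VSpace n → VSpace n) (z : VSpace n) : ⋀[ℝ]^n (WSpace n) :=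
  exteriorPower.ιMulti ℝ n fun i =>
    fderiv ℝ (fun z => (p z, q z)) z (EuclideanSpace.single i 1)

namespace IsPolarSplitting

variable {p q : VSpace n → VSpace n} {s : VSpace n → ℝ}

theorem hasFDerivAt_right (h : IsPolarSplitting p q s) {z : VSpace n}
    (hz : DifferentiableAt ℝ p z) :
    HasFDerivAt q (ContinuousLinearMap.id ℝ _ - fderiv ℝ p z) z := by
  have : q = fun z => z - p z := funext fun z => eq_sub_of_add_eq' (h.add z)
  rw [this]
  exact (hasFDerivAt_id z).sub hz.hasFDerivAt

/-- With `A₁`, `A₂` the matrices of the derivatives of `p`, the block determinant is that of `1 -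
(2A₁ - 1)(2A₂ - 1) = 2(A₁ + A₂ - 2A₁A₂)`. Since `A₁` is symmetric, the entries of the last bracket
are the pairings of the tangent vectors `(P₁ eᵢ, eᵢ - P₁ eᵢ)` and `(P₂ eⱼ, eⱼ - P₂ eⱼ)`. -/
theorem det_id_add_fderiv_crossReflection (h : IsPolarSplitting p q s) {ζ : WSpace n}
    (h₁ : DifferentiableAt ℝ p ζ.1) (h₂ : DifferentiableAt ℝ p ζ.2) :
    (ContinuousLinearMap.id ℝ (WSpace n) + fderiv ℝ (crossReflection p q) ζ).det =
      2 ^ n * exteriorForm n n (coneTangent p q ζ.1) (coneTangent p q ζ.2) := by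
  set P₁ := fderiv ℝ p ζ.1
  set P₂ := fderiv ℝ p ζ.2
  have hg : ∀ {z}, DifferentiableAt ℝ p z → HasFDerivAt (fun z => p z - q z)
      (fderiv ℝ p z - (ContinuousLinearMap.id ℝ _ - fderiv ℝ p z)) z := fun hz =>
    hz.hasFDerivAt.sub (h.hasFDerivAt_right hz)
  have hG : HasFDerivAt (crossReflection p q)
      (((P₂ - (ContinuousLinearMap.id ℝ _ - P₂)).comp
          (ContinuousLinearMap.snd ℝ (VSpace n) (VSpace n))).prod
        ((P₁ - (ContinuousLinearMap.id ℝ _ - P₁)).comp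
          (ContinuousLinearMap.fst ℝ (VSpace n) (VSpace n)))) ζ :=
    ((hg h₂).comp ζ hasFDerivAt_snd).prodMk ((hg h₁).comp ζ hasFDerivAt_fst)
  have hU : ∀ {z}, DifferentiableAt ℝ p z → fderiv ℝ (fun z => (p z, q z)) z =
      (fderiv ℝ p z).prod (ContinuousLinearMap.id ℝ _ - fderiv ℝ p z) := fun hz =>
    (hz.hasFDerivAt.prodMk (h.hasFDerivAt_right hz)).fderiv
  rw [hG.fderiv, det_id_add_swap, coneTangent, coneTangent, exteriorForm_ιMulti, hU h₁, hU h₂]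
  set A₁ : Matrix (Fin n) (Fin n) ℝ := Matrix.of fun i j => P₁ (EuclideanSpace.single j 1) i
  set A₂ : Matrix (Fin n) (Fin n) ℝ := Matrix.of fun i j => P₂ (EuclideanSpace.single j 1) i
  have hB : ∀ P : VSpace n →L[ℝ] VSpace n,
      (Matrix.of fun i j =>
        (P - (ContinuousLinearMap.id ℝ (VSpace n) - P)) (EuclideanSpace.single j 1) i) =
        (2 : ℝ) • (Matrix.of fun i j => P (EuclideanSpace.single j 1) i) - 1 := by
    intro P
    ext i j
    simp [Matrix.one_apply]
    ring
  rw [hB P₁, hB P₂]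
  have e1 : (1 : Matrix (Fin n) (Fin n) ℝ) - ((2 : ℝ) • A₁ - 1) * ((2 : ℝ) • A₂ - 1) =
      (2 : ℝ) • (A₁ + A₂ - (2 : ℝ) • (A₁ * A₂)) := by
    simp only [sub_mul, mul_sub, Matrix.smul_mul, Matrix.mul_smul, one_mul, mul_one]
    module
  rw [e1, Matrix.det_smul, Fintype.card_fin]
  congr 2
  ext i j
  have hcoord : ∀ (x : VSpace n) (k : Fin n), ⟪x, EuclideanSpace.single k (1 : ℝ)⟫ = x k := by
    intro x k
    simp [EuclideanSpace.inner_single_right]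
  have hsymm : ∀ i j, P₁ (EuclideanSpace.single i 1) j = P₁ (EuclideanSpace.single j 1) i := by
    intro i j
    rw [← hcoord, ← hcoord]
    exact h.fderiv_fst_symm h₁ _ _
  have hprod : ⟪P₁ (EuclideanSpace.single i 1), P₂ (EuclideanSpace.single j 1)⟫ =
      ∑ k, A₁ i k * A₂ k j := by
    rw [PiLp.inner_apply]
    refine Finset.sum_congr rfl fun k _ => ?_
    simp only [A₁, A₂, Matrix.of_apply, RCLike.inner_apply, conj_trivial]
    rw [hsymm i k, mul_comm]
  simp only [Matrix.sub_apply, Matrix.add_apply, Matrix.smul_apply, Matrix.mul_apply,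
    Matrix.of_apply, ContinuousLinearMap.prod_apply, sub_apply,
    ContinuousLinearMap.id_apply, inner_sub_right, ← hprod, smul_eq_mul]
  rw [hcoord, hcoord, real_inner_comm (P₁ (EuclideanSpace.single i 1))
    (P₂ (EuclideanSpace.single j 1)), hsymm i j]
  simp only [A₁, A₂, Matrix.of_apply]
  ring

end IsPolarSplitting

end ConeTangent

/-! ### The volume of the heart as an energy -/

section JoinVolume

variable {n : ℕ}

instance : (volume : Measure (WSpace n)).IsAddHaarMeasure :=
  inferInstanceAs ((volume : Measure (VSpace n)).prod volume).IsAddHaarMeasure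

theorem integrable_exp_neg_mul_norm {E : Type*} [NormedAddCommGroup E] [NormedSpace ℝ E]
    [FiniteDimensional ℝ E] [MeasurableSpace E] [BorelSpace E] (μ : Measure E)
    [μ.IsAddHaarMeasure] {c : ℝ} (hc : 0 < c) :
    Integrable (fun x : E => Real.exp (-(c * ‖x‖))) μ := by
  have := (integral_exp_neg_mul_of_homogeneous μ (ρ := fun x : E => c * ‖x‖) (F := fun _ => 1)
    (by fun_prop) (fun r hr x => by rw [norm_smul, Real.norm_of_nonneg hr.le]; ring) hc
    (fun x => le_rfl) measurable_const (M := 1) (fun x => by simp) (fun _ _ _ => rfl)).1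
  simpa using this

theorem integral_comp_diagonalEquiv (f : WSpace n → ℝ) :
    ∫ w, f w = (2⁻¹ : ℝ) ^ n * ∫ w, f (diagonalEquiv n w) := by
  rw [(diagonalEquiv n : WSpace n →L[ℝ] WSpace n).lipschitz.integral_comp_bijective volume
    (diagonalEquiv n).bijective f, ← integral_const_mul]
  refine integral_congr_ae (ae_of_all _ fun w => ?_)
  simp only [ContinuousLinearMap.fderiv, abs_det_diagonalEquiv, smul_eq_mul]
  rfl

/-- The weak integral of a map into a finite-dimensional space exists. -/
theorem exists_weak_integral {X F : Type*} [MeasurableSpace X] {μ : Measure X} [AddCommGroup F]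
    [Module ℝ F] [Module.Finite ℝ F] (τ : X → F)
    (hτ : ∀ l : Module.Dual ℝ F, Integrable (fun x => l (τ x)) μ) :
    ∃ ω : F, ∀ l : Module.Dual ℝ F, l ω = ∫ x, l (τ x) ∂μ := by
  let I : Module.Dual ℝ (Module.Dual ℝ F) :=
    { toFun := fun l => ∫ x, l (τ x) ∂μ
      map_add' := fun l l' => integral_add (hτ l) (hτ l')
      map_smul' := fun r l => integral_const_mul r _ }
  refine ⟨(Module.evalEquiv ℝ F).symm I, fun l => ?_⟩
  rw [Module.apply_evalEquiv_symm_apply]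
  rfl

theorem measurable_form_fderiv {k : ℕ} {W : Type*} [NormedAddCommGroup W] [NormedSpace ℝ W]
    [FiniteDimensional ℝ W] [MeasurableSpace W] [BorelSpace W] (A : W [⋀^Fin k]→ₗ[ℝ] ℝ)
    (f : VSpace k → W) :
    Measurable fun z => A fun i => fderiv ℝ f z (EuclideanSpace.single i 1) :=
  measurable_comp_fderiv f A.continuous_apply_comp

/-- The linear functional `ν ↦ ⟨ω, ν⟩` on `k`-vectors. -/
noncomputable def exteriorFormRight {k : ℕ} (ω : ⋀[ℝ]^k (WSpace n)) :
    Module.Dual ℝ (⋀[ℝ]^k (WSpace n)) :=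
  exteriorPower.pairingDual ℝ (WSpace n) k (exteriorPower.map k (pairingForm n) ω)

/-- The linear functional `ω ↦ ⟨ω, ν⟩` on `k`-vectors. -/
noncomputable def exteriorFormLeft {k : ℕ} (ν : ⋀[ℝ]^k (WSpace n)) :
    Module.Dual ℝ (⋀[ℝ]^k (WSpace n)) :=
  (exteriorPower.pairingDual ℝ (WSpace n) k ∘ₗ exteriorPower.map k (pairingForm n)).flip ν

theorem exteriorFormRight_apply {k : ℕ} (ω ν : ⋀[ℝ]^k (WSpace n)) :
    exteriorFormRight ω ν = exteriorForm n k ω ν := rfl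

theorem exteriorFormLeft_apply {k : ℕ} (ω ν : ⋀[ℝ]^k (WSpace n)) :
    exteriorFormLeft ν ω = exteriorForm n k ω ν := rfl

namespace IsPolarSplitting

variable {p q : VSpace n → VSpace n} {s : VSpace n → ℝ}

theorem lipschitz_prodMk (h : IsPolarSplitting p q s) : LipschitzWith 1 fun z => (p z, q z) := by
  simpa using h.lipschitz_fst.prodMk h.lipschitz_snd

theorem measurable_apply_coneTangent (l : Module.Dual ℝ (⋀[ℝ]^n (WSpace n))) :
    Measurable fun z => l (coneTangent p q z) :=
  measurable_form_fderiv (l.compAlternatingMap (exteriorPower.ιMulti ℝ n)) fun z => (p z, q z)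

theorem exists_bound_apply_coneTangent (h : IsPolarSplitting p q s)
    (l : Module.Dual ℝ (⋀[ℝ]^n (WSpace n))) : ∃ M, ∀ z, ‖l (coneTangent p q z)‖ ≤ M :=
  h.lipschitz_prodMk.exists_bound_comp_fderiv
    (l.compAlternatingMap (exteriorPower.ιMulti ℝ n)).continuous_apply_comp

theorem coneTangent_smul (h : IsPolarSplitting p q s) {r : ℝ} (hr : r ≠ 0) (z : VSpace n) :
    coneTangent p q (r • z) = coneTangent p q z := by
  have h1 := fderiv_comp_smul (𝕜 := ℝ) (f := fun z => (p z, q z)) (x := z) r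
  have h2 : (fun z => (p (r • z), q (r • z))) = r • fun z => (p z, q z) := by
    ext1 z
    simp only [h.smul_fst, h.smul_snd, Pi.smul_apply, Prod.smul_mk]
  have h3 : fderiv ℝ (r • fun z => (p z, q z)) z = r • fderiv ℝ (fun z => (p z, q z)) z :=
    congrFun (fderiv_const_smul_field (R := ℝ) (f := fun z => (p z, q z)) r) z
  rw [h2, h3] at h1
  rw [coneTangent, coneTangent, smul_right_injective _ hr h1]

theorem integral_exp_neg_apply_coneTangent (h : IsPolarSplitting p q s)
    (l : Module.Dual ℝ (⋀[ℝ]^n (WSpace n))) :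
    ∫ z, Real.exp (-s z) * l (coneTangent p q z) =
      n.factorial * ∫ z in {z | s z ≤ 1}, l (coneTangent p q z) := by
  obtain ⟨c, hc, hcs⟩ := h.lower
  obtain ⟨M, hM⟩ := h.exists_bound_apply_coneTangent l
  have := (integral_exp_neg_mul_of_homogeneous volume h.lipschitz_level.continuous.measurable
    (fun r hr z => h.level_smul_of_pos r hr z) hc hcs (measurable_apply_coneTangent l) hM
    (fun r hr z => by rw [h.coneTangent_smul hr.ne'])).2
  rwa [finrank_euclideanSpace_fin] at this

theorem integrable_exp_neg_level (h : IsPolarSplitting p q s) :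
    Integrable fun z => Real.exp (-s z) := by
  obtain ⟨c, hc, hcs⟩ := h.lower
  refine (integrable_exp_neg_mul_norm volume hc).mono'
    (Real.continuous_exp.comp h.lipschitz_level.continuous.neg).aestronglyMeasurable
    (ae_of_all _ fun z => ?_)
  rw [Real.norm_eq_abs, Real.abs_exp]
  exact Real.exp_le_exp.2 (neg_le_neg (hcs z))

/-- The directed volume of the cone over `K⁺`, truncated by `K⁺`. -/
theorem exists_coneVolume (h : IsPolarSplitting p q s) : ∃ ω : ⋀[ℝ]^n (WSpace n),
    ∀ l : Module.Dual ℝ (⋀[ℝ]^n (WSpace n)),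
      l ω = ∫ z in {z | s z ≤ 1}, l (coneTangent p q z) := by
  obtain ⟨c, hc, hcs⟩ := h.lower
  refine exists_weak_integral (coneTangent p q) fun l => ?_
  refine h.lipschitz_prodMk.integrableOn_comp_fderiv volume
    (l.compAlternatingMap (exteriorPower.ιMulti ℝ n)).continuous_apply_comp
    (ne_top_of_le_ne_top (isCompact_closedBall (0 : VSpace n) (1 / c)).measure_ne_top
      (measure_mono fun z hz => ?_))
  rw [mem_closedBall_zero_iff, le_div_iff₀ hc, mul_comm]
  exact (hcs z).trans hz

/-- For `t < 1` the map `id + tG` is a bijection with positive Jacobian, so the transformed integral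
does not depend on `t`. Dominated convergence reaches `t = 1`, where the map is `joinMap` up to
`diagonalEquiv`. -/
theorem integral_exp_neg_eq_integral_det (h : IsPolarSplitting p q s) {N : WSpace n → ℝ}
    (hcont : Continuous N) (hN : ∀ ζ, N (joinMap p q ζ) = s ζ.1 + s ζ.2)
    {c : ℝ} (hc : 0 < c) (hcN : ∀ w, c * ‖w‖ ≤ N w) :
    ∫ w, Real.exp (-N w) = (2⁻¹ : ℝ) ^ n * ∫ ζ : WSpace n,
      (ContinuousLinearMap.id ℝ (WSpace n) + fderiv ℝ (crossReflection p q) ζ).det *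
        Real.exp (-(s ζ.1 + s ζ.2)) := by
  rw [integral_comp_diagonalEquiv]
  congr 1
  set G := crossReflection p q
  have hGlip := h.lipschitz_crossReflection
  set f : WSpace n → ℝ := fun w => Real.exp (-N (diagonalEquiv n w))
  have hf : Continuous f :=
    Real.continuous_exp.comp (hcont.comp (diagonalEquiv n).continuous).neg
  obtain ⟨c₁, hc₁, hlow⟩ := h.crossReflection_lower_bound
  set d : ℝ := ‖((diagonalEquiv n).symm : WSpace n →L[ℝ] WSpace n)‖ + 1
  have hd0 : 0 < d := by positivity
  have hd : ∀ w, ‖w‖ ≤ d * ‖diagonalEquiv n w‖ := fun w => by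
    have h1 := ((diagonalEquiv n).symm : WSpace n →L[ℝ] WSpace n).le_opNorm (diagonalEquiv n w)
    have h2 : ((diagonalEquiv n).symm : WSpace n →L[ℝ] WSpace n) (diagonalEquiv n w) = w :=
      (diagonalEquiv n).symm_apply_apply w
    rw [h2] at h1
    exact h1.trans (mul_le_mul_of_nonneg_right (by simp [d]) (norm_nonneg _))
  set b : ℝ := c * (c₁ / d)
  have hb : 0 < b := by positivity
  -- The integrable majorant, uniform in `t`.
  have hfb : ∀ t : ℝ, 0 ≤ t → t ≤ 1 → ∀ ζ, ‖f (ζ + t • G ζ)‖ ≤ Real.exp (-(b * ‖ζ‖)) := by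
    intro t ht0 ht1 ζ
    rw [Real.norm_eq_abs, Real.abs_exp]
    refine Real.exp_le_exp.2 (neg_le_neg ((?_ : b * ‖ζ‖ ≤ _).trans (hcN _)))
    rw [mul_assoc]
    refine mul_le_mul_of_nonneg_left ?_ hc.le
    rw [div_mul_eq_mul_div, div_le_iff₀ hd0, mul_comm _ d]
    exact (hlow t ht0 ht1 ζ).trans (hd _)
  have hint : Integrable (fun ζ : WSpace n => Real.exp (-(b * ‖ζ‖))) :=
    integrable_exp_neg_mul_norm volume hb
  have hdetc : Continuous fun z : ℝ × (WSpace n →L[ℝ] WSpace n) =>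
      (ContinuousLinearMap.id ℝ (WSpace n) + z.1 • z.2).det :=
    ContinuousLinearMap.continuous_det.comp (by fun_prop)
  obtain ⟨M, hM⟩ := ((isCompact_Icc (a := (0 : ℝ)) (b := 1)).prod (isCompact_closedBall
    (0 : WSpace n →L[ℝ] WSpace n) 1)).exists_bound_of_continuousOn hdetc.continuousOn
  have hGn : ∀ ζ, ‖fderiv ℝ G ζ‖ ≤ 1 := fun ζ => norm_fderiv_le_of_lipschitz ℝ hGlip
  have hdet : ∀ t : ℝ, 0 ≤ t → t ≤ 1 → ∀ ζ,
      ‖(ContinuousLinearMap.id ℝ (WSpace n) + t • fderiv ℝ G ζ).det‖ ≤ M := fun t ht0 ht1 ζ =>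
    hM (t, fderiv ℝ G ζ) ⟨⟨ht0, ht1⟩, by simpa using hGn ζ⟩
  have hM0 : 0 ≤ M := (norm_nonneg _).trans (hdet 0 le_rfl zero_le_one 0)
  set Φ : ℝ → WSpace n → ℝ := fun t ζ =>
    (ContinuousLinearMap.id ℝ (WSpace n) + t • fderiv ℝ G ζ).det * f (ζ + t • G ζ)
  have hΦ : ∀ t : ℝ, 0 ≤ t → t < 1 → ∫ ζ, Φ t ζ = ∫ w, f w := by
    intro t ht0 ht1
    lift t to NNReal using ht0
    have hk : t < 1 := by exact_mod_cast ht1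
    have h1 := h.lipschitz_smul_crossReflection t
    have h2 := h1.setIntegral_image_id_add volume hk MeasurableSet.univ f
    rw [image_univ, (bijective_add_of_lipschitz h1 hk).surjective.range_eq, setIntegral_univ,
      setIntegral_univ] at h2
    rw [h2]
    refine integral_congr_ae (ae_of_all _ fun ζ => ?_)
    have h3 : fderiv ℝ (fun ζ => (t : ℝ) • G ζ) ζ = (t : ℝ) • fderiv ℝ G ζ :=
      congrFun (fderiv_const_smul_field (R := ℝ) (f := G) (t : ℝ)) ζ
    simp only [Φ, ← h3]
    rfl
  have hmeas : ∀ t : ℝ, AEStronglyMeasurable (Φ t) volume := fun t => by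
    have h1 : Measurable fun ζ =>
        (ContinuousLinearMap.id ℝ (WSpace n) + t • fderiv ℝ G ζ).det :=
      measurable_comp_fderiv G (φ := fun D => (ContinuousLinearMap.id ℝ (WSpace n) + t • D).det)
        (hdetc.comp (by fun_prop : Continuous fun D => (t, D)))
    have h2 : Measurable fun ζ => f (ζ + t • G ζ) :=
      (hf.comp (continuous_id.add (hGlip.continuous.const_smul t))).measurable
    exact (h1.mul h2).aestronglyMeasurable
  have hmem : ∀ᶠ t in nhdsWithin (1 : ℝ) (Iio 1), 0 ≤ t ∧ t < 1 := by
    filter_upwards [Ioo_mem_nhdsLT (zero_lt_one' ℝ)] with t ht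
    exact ⟨ht.1.le, ht.2⟩
  have hlim : Filter.Tendsto (fun t => ∫ ζ, Φ t ζ) (nhdsWithin (1 : ℝ) (Iio 1))
      (nhds (∫ ζ, Φ 1 ζ)) := by
    refine tendsto_integral_filter_of_dominated_convergence
      (fun ζ => M * Real.exp (-(b * ‖ζ‖))) (Filter.Eventually.of_forall hmeas) ?_
      (hint.const_mul M) (ae_of_all _ fun ζ => ?_)
    · filter_upwards [hmem] with t ht
      refine ae_of_all _ fun ζ => ?_
      rw [norm_mul]
      exact mul_le_mul (hdet t ht.1 ht.2.le ζ) (hfb t ht.1 ht.2.le ζ) (norm_nonneg _) hM0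
    · have hc1 : Continuous fun t : ℝ => Φ t ζ :=
        (hdetc.comp (by fun_prop : Continuous fun t : ℝ => (t, fderiv ℝ G ζ))).mul
          (hf.comp (by fun_prop))
      exact hc1.continuousAt.tendsto.mono_left nhdsWithin_le_nhds
  have hconst : Filter.Tendsto (fun t => ∫ ζ, Φ t ζ) (nhdsWithin (1 : ℝ) (Iio 1))
      (nhds (∫ w, f w)) :=
    tendsto_const_nhds.congr' (by
      filter_upwards [hmem] with t ht
      exact (hΦ t ht.1 ht.2).symm)
  rw [tendsto_nhds_unique hconst hlim]
  refine integral_congr_ae (ae_of_all _ fun ζ => ?_)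
  simp only [Φ, f, one_smul, G, ← h.joinMap_eq, hN]

/-- The volume of the region enclosed by the join, in terms of the energy. -/
theorem choose_mul_volume_eq_energy (h : IsPolarSplitting p q s) {N : WSpace n → ℝ}
    (hcont : Continuous N) (hN : ∀ ζ, N (joinMap p q ζ) = s ζ.1 + s ζ.2)
    (hhom : ∀ r : ℝ, 0 < r → ∀ w, N (r • w) = r * N w)
    {c : ℝ} (hc : 0 < c) (hcN : ∀ w, c * ‖w‖ ≤ N w) {ω : ⋀[ℝ]^n (WSpace n)}
    (hω : ∀ l : Module.Dual ℝ (⋀[ℝ]^n (WSpace n)),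
      l ω = ∫ z in {z | s z ≤ 1}, l (coneTangent p q z)) :
    ((2 * n).choose n : ℝ) * volume.real {w | N w ≤ 1} = energy ω := by
  have h1 := (integral_exp_neg_mul_of_homogeneous volume (ρ := N) (F := fun _ => 1)
    hcont.measurable hhom hc hcN measurable_const (M := 1) (fun x => by simp)
    (fun _ _ _ => rfl)).2
  simp only [mul_one, setIntegral_const, smul_eq_mul, Module.finrank_prod,
    finrank_euclideanSpace_fin, ← two_mul] at h1
  rw [h.integral_exp_neg_eq_integral_det hcont hN hc hcN, ← integral_const_mul] at h1
  set f : WSpace n → ℝ := fun ζ => (2⁻¹ : ℝ) ^ n *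
    ((ContinuousLinearMap.id ℝ (WSpace n) + fderiv ℝ (crossReflection p q) ζ).det *
        Real.exp (-(s ζ.1 + s ζ.2)))
  have hfint : Integrable f := by
    have hc1 : Continuous fun D : WSpace n →L[ℝ] WSpace n =>
        (ContinuousLinearMap.id ℝ (WSpace n) + D).det :=
      ContinuousLinearMap.continuous_det.comp (by fun_prop)
    obtain ⟨M, hM⟩ := h.lipschitz_crossReflection.exists_bound_comp_fderiv hc1
    refine (Integrable.bdd_mul ?_ (measurable_comp_fderiv _ hc1).aestronglyMeasurable
      (ae_of_all _ hM)).const_mul _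
    have := h.integrable_exp_neg_level.mul_prod h.integrable_exp_neg_level
    refine this.congr (ae_of_all _ fun ζ => ?_)
    simp only [neg_add, Real.exp_add]
  have hae : ∀ᵐ ζ : WSpace n, f ζ = Real.exp (-s ζ.1) * (Real.exp (-s ζ.2) *
      exteriorForm n n (coneTangent p q ζ.1) (coneTangent p q ζ.2)) := by
    have hd : ∀ᵐ z, DifferentiableAt ℝ p z := h.lipschitz_fst.ae_differentiableAt
    filter_upwards [(Measure.quasiMeasurePreserving_fst (μ := (volume : Measure (VSpace n)))
        (ν := (volume : Measure (VSpace n)))).ae hd,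
      (Measure.quasiMeasurePreserving_snd (μ := (volume : Measure (VSpace n)))
        (ν := (volume : Measure (VSpace n)))).ae hd] with ζ h₁ h₂
    simp only [f]
    rw [h.det_id_add_fderiv_crossReflection h₁ h₂, neg_add, Real.exp_add]
    have : (2⁻¹ : ℝ) ^ n * 2 ^ n = 1 := by rw [← mul_pow]; norm_num
    linear_combination (exteriorForm n n (coneTangent p q ζ.1) (coneTangent p q ζ.2) *
      (Real.exp (-s ζ.1) * Real.exp (-s ζ.2))) * this
  -- By Fubini and bilinearity, each variable integrates to `n!` times `ω` in its slot of the
  -- pairing.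
  have h2 : ∫ ζ, f ζ = n.factorial * (n.factorial * energy ω) := by
    rw [integral_congr_ae hae, Measure.volume_eq_prod, integral_prod _ (hfint.congr hae)]
    have h3 : ∀ z, ∫ z', Real.exp (-s z) * (Real.exp (-s z') *
        exteriorForm n n (coneTangent p q z) (coneTangent p q z')) =
        n.factorial * (Real.exp (-s z) * exteriorFormLeft ω (coneTangent p q z)) := by
      intro z
      have h4 := h.integral_exp_neg_apply_coneTangent (exteriorFormRight (coneTangent p q z))
      rw [← hω] at h4
      rw [integral_const_mul]
      simp only [exteriorFormRight_apply] at h4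
      rw [h4, exteriorFormLeft_apply]
      ring
    simp only [h3]
    rw [integral_const_mul, h.integral_exp_neg_apply_coneTangent, ← hω]
    rfl
  rw [h2] at h1
  have h5 : ((2 * n).factorial : ℝ) = (2 * n).choose n * n.factorial * n.factorial := by
    have := Nat.choose_mul_factorial_mul_factorial (show n ≤ 2 * n by omega)
    rw [show 2 * n - n = n by omega] at this
    exact_mod_cast this.symm
  rw [h5] at h1
  have hn : (n.factorial : ℝ) ≠ 0 := by exact_mod_cast n.factorial_ne_zero
  refine mul_left_cancel₀ hn (mul_left_cancel₀ hn ?_)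
  rw [h1]
  ring

end IsPolarSplitting

end JoinVolume

/-! ### Inverting homogeneous extensions -/

section ConeExtensionInverse

variable {E F : Type*} [NormedAddCommGroup E] [NormedSpace ℝ E] [NormedAddCommGroup F]
  [NormedSpace ℝ F]

theorem coneExtension_of_eq_one {ν : E → ℝ} (k : E → F) {x : E} (hx : ν x = 1) :
    coneExtension ν k x = k x := by
  rw [coneExtension, hx, inv_one, one_smul, one_smul]

theorem inv_smul_mem_level {ν : E → ℝ} (hν : ∀ r : ℝ, 0 < r → ∀ x, ν (r • x) = r * ν x)
    (hpos : ∀ x, x ≠ 0 → 0 < ν x) {x : E} (hx : x ≠ 0) : ν ((ν x)⁻¹ • x) = 1 := by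
  rw [hν _ (inv_pos.2 (hpos x hx)), inv_mul_cancel₀ (hpos x hx).ne']

theorem level_coneExtension {ν : E → ℝ} {ν' : F → ℝ}
    (hν : ∀ r : ℝ, 0 < r → ∀ x, ν (r • x) = r * ν x) (hpos : ∀ x, x ≠ 0 → 0 < ν x)
    (h0 : ν 0 = 0) (h0' : ν' 0 = 0) (hν' : ∀ r : ℝ, 0 < r → ∀ x, ν' (r • x) = r * ν' x)
    {k : E → F} (hk : ∀ x, ν x = 1 → ν' (k x) = 1) (x : E) :
    ν' (coneExtension ν k x) = ν x := by
  by_cases hx : x = 0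
  · rw [hx, coneExtension, h0, zero_smul, h0']
  · rw [coneExtension, hν' _ (hpos x hx), hk _ (inv_smul_mem_level hν hpos hx), mul_one]

theorem leftInverse_coneExtension {ν : E → ℝ} {ν' : F → ℝ}
    (hν : ∀ r : ℝ, 0 < r → ∀ x, ν (r • x) = r * ν x) (hpos : ∀ x, x ≠ 0 → 0 < ν x)
    (h0 : ν 0 = 0) (h0' : ν' 0 = 0) (hν' : ∀ r : ℝ, 0 < r → ∀ x, ν' (r • x) = r * ν' x)
    {k : E → F} {k' : F → E} (hk : ∀ x, ν x = 1 → ν' (k x) = 1)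
    (hkk : ∀ x, ν x = 1 → k' (k x) = x) :
    Function.LeftInverse (coneExtension ν' k') (coneExtension ν k) := by
  intro x
  have h1 := level_coneExtension hν hpos h0 h0' hν' hk x
  rw [coneExtension, h1]
  by_cases hx : x = 0
  · rw [hx, h0, zero_smul]
  · have hne := (hpos x hx).ne'
    rw [coneExtension, smul_smul, inv_mul_cancel₀ hne, one_smul,
      hkk _ (inv_smul_mem_level hν hpos hx), smul_smul, mul_inv_cancel₀ hne, one_smul]

theorem exists_lipschitzWith_coneExtension_norm {k : E → F} {D : NNReal}
    (hk : LipschitzOnWith D k (sphere 0 1)) {M : ℝ} (hM0 : 0 ≤ M)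
    (hM : ∀ x, ‖x‖ = 1 → ‖k x‖ ≤ M) :
    ∃ C : NNReal, LipschitzWith C (coneExtension (fun x => ‖x‖) k) := by
  refine lipschitzWith_coneExtension lipschitzWith_one_norm (fun r hr x => ?_) one_pos
    (fun x => by rw [one_mul]) (hk.mono fun x hx => mem_sphere_zero_iff_norm.2 hx) hM0 hM
  rw [norm_smul, Real.norm_of_nonneg hr.le]

end ConeExtensionInverse

/-! ### Directed volumes of disks, and the implication between the conjectures -/

section DirectedVolume

variable {n : ℕ} {p q : VSpace n → VSpace n} {s : VSpace n → ℝ} {K : Set (VSpace n)}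

/-- The integral of a form over the image under a bi-Lipschitz reparametrization. -/
theorem setIntegral_form_comp_biLipschitz {W : Type*} [NormedAddCommGroup W] [NormedSpace ℝ W]
    [FiniteDimensional ℝ W] {U : VSpace n → W} {C : NNReal} (hU : LipschitzWith C U)
    {H H' : VSpace n → VSpace n} {D D' : NNReal}
    (hH : LipschitzWith D H) (hH' : LipschitzWith D' H') (hl : Function.LeftInverse H' H)
    (hr : Function.RightInverse H' H) :
    ∃ σ : ℝ, (σ = 1 ∨ σ = -1) ∧ ∀ (A : W [⋀^Fin n]→ₗ[ℝ] ℝ) (S : Set (VSpace n)),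
      MeasurableSet S →
      ∫ x in S, A (fun i => fderiv ℝ (U ∘ H) x (EuclideanSpace.single i 1)) =
        σ * ∫ z in H '' S, A (fun i => fderiv ℝ U z (EuclideanSpace.single i 1)) := by
  obtain ⟨σ, hσ, hdet⟩ := exists_sign_det_fderiv volume hH hH' hl hr
  refine ⟨σ, hσ, fun A S hS => ?_⟩
  rw [hH.setIntegral_image volume hl.injective hS, ← integral_const_mul]
  refine setIntegral_congr_ae hS ?_
  have hUd : ∀ᵐ z, DifferentiableAt ℝ U z := hU.ae_differentiableAt
  filter_upwards [hdet, hH.ae_differentiableAt, hH'.ae_comp_of_leftInverse volume hl hUd]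
    with x h1 h2 h3 _
  rw [(h3.hasFDerivAt.comp x h2.hasFDerivAt).fderiv, A.apply_comp_comp, smul_eq_mul, ← mul_assoc,
    ← h1]

namespace IsPolarSplitting

/-- Every directed volume enclosed by `K⁺` is, up to sign, the directed volume of the cone. -/
theorem eq_or_eq_neg_of_isEnclosedDirectedVolume [NeZero n] (h : IsPolarSplitting p q s)
    (hK : kPlus K = {w | ∃ z, s z = 1 ∧ w = (p z, q z)}) {ω₀ ω : ⋀[ℝ]^n (WSpace n)}
    (hω₀ : ∀ l : Module.Dual ℝ (⋀[ℝ]^n (WSpace n)),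
      l ω₀ = ∫ z in {z | s z ≤ 1}, l (coneTangent p q z))
    (hω : IsEnclosedDirectedVolume (kPlus K) ω) : ω = ω₀ ∨ ω = -ω₀ := by
  obtain ⟨f, ⟨⟨C, hC⟩, hbd, c, hc, hbi⟩, hf⟩ := hω
  have hfs : ∀ x ∈ sphere (0 : VSpace n) 1, ∃ z, s z = 1 ∧ f x = (p z, q z) := fun x hx => by
    have : f x ∈ kPlus K := hbd ▸ mem_image_of_mem f hx
    rwa [hK] at this
  -- Since `p + q` is the identity, summing components reads off the parameter on the level set `s =
  -- 1`.
  set k : VSpace n → VSpace n := fun x => (f x).1 + (f x).2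
  have hk : ∀ x ∈ sphere (0 : VSpace n) 1, s (k x) = 1 ∧ f x = (p (k x), q (k x)) := by
    intro x hx
    obtain ⟨z, hz, e⟩ := hfs x hx
    have : k x = z := by simp only [k, e, h.add]
    rw [this]
    exact ⟨hz, e⟩
  -- The inverse of `k` on the level set; off it the chosen values are irrelevant.
  have hex : ∀ z, ∃ x, s z = 1 → x ∈ sphere (0 : VSpace n) 1 ∧ f x = (p z, q z) := by
    intro z
    by_cases hz : s z = 1
    · have : (p z, q z) ∈ f '' sphere 0 1 := by
        rw [hbd, hK]
        exact ⟨z, hz, rfl⟩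
      obtain ⟨x, hx, e⟩ := this
      exact ⟨x, fun _ => ⟨hx, e⟩⟩
    · exact ⟨0, fun hz' => absurd hz' hz⟩
  choose k' hk' using hex
  have hinj : ∀ x ∈ sphere (0 : VSpace n) 1, ∀ y ∈ sphere (0 : VSpace n) 1,
      f x = f y → x = y := by
    intro x hx y hy e
    have := hbi x hx y hy
    rw [e, dist_self] at this
    exact dist_le_zero.1 (by nlinarith [dist_nonneg (x := x) (y := y)])
  have hklip : LipschitzOnWith (C + C) k (sphere 0 1) := by
    have hC' := hC.mono sphere_subset_closedBall
    refine LipschitzOnWith.of_dist_le_mul fun x hx y hy => ?_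
    have h1 := hC'.dist_le_mul x hx y hy
    rw [Prod.dist_eq] at h1
    have h2 := dist_add_add_le (f x).1 (f x).2 (f y).1 (f y).2
    have h3 := (le_max_left _ _).trans h1
    have h4 := (le_max_right _ _).trans h1
    push_cast
    linarith
  have hklip' : LipschitzOnWith (c⁻¹).toNNReal k' {z | s z = 1} := by
    refine LipschitzOnWith.of_dist_le_mul fun z hz y hy => ?_
    rw [Real.coe_toNNReal _ (inv_nonneg.2 hc.le)]
    obtain ⟨h1, h2⟩ := hk' z hz
    obtain ⟨h3, h4⟩ := hk' y hy
    have h5 := hbi _ h1 _ h3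
    rw [h2, h4] at h5
    have h6 := h.lipschitz_prodMk.dist_le_mul z y
    rw [NNReal.coe_one, one_mul] at h6
    rw [le_inv_mul_iff₀ hc]
    exact h5.trans h6
  obtain ⟨M, hM⟩ := ((isCompact_sphere (0 : VSpace n) 1).exists_bound_of_continuousOn
    hklip.continuousOn)
  obtain ⟨D, hD⟩ := exists_lipschitzWith_coneExtension_norm hklip (le_max_right M 0)
    fun x hx => (hM x (mem_sphere_zero_iff_norm.2 hx)).trans (le_max_left _ _)
  obtain ⟨c₀, hc₀, hcs⟩ := h.lower
  obtain ⟨D', hD'⟩ := lipschitzWith_coneExtension h.lipschitz_level h.level_smul_of_pos hc₀ hcs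
    hklip' zero_le_one fun z hz => (mem_sphere_zero_iff_norm.1 (hk' z hz).1).le
  have hnorm : ∀ r : ℝ, 0 < r → ∀ x : VSpace n, ‖r • x‖ = r * ‖x‖ := fun r hr x => by
    rw [norm_smul, Real.norm_of_nonneg hr.le]
  have hnormpos : ∀ x : VSpace n, x ≠ 0 → 0 < ‖x‖ := fun x hx => norm_pos_iff.2 hx
  have hl := leftInverse_coneExtension (k' := k') hnorm hnormpos norm_zero h.level_zero
    h.level_smul_of_pos (fun x hx => (hk x (mem_sphere_zero_iff_norm.2 hx)).1) (fun x hx => by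
      have hx := mem_sphere_zero_iff_norm.2 hx
      obtain ⟨h1, h2⟩ := hk x hx
      obtain ⟨h3, h4⟩ := hk' _ h1
      exact hinj _ h3 _ hx (h4.trans h2.symm))
  have hknorm : ∀ z, s z = 1 → ‖k' z‖ = 1 := fun z hz => mem_sphere_zero_iff_norm.1 (hk' z hz).1
  have hr := leftInverse_coneExtension (k' := k) h.level_smul_of_pos (fun _ => h.level_pos)
    h.level_zero norm_zero hnorm hknorm (fun z hz => by
      simp only [k, (hk' z hz).2, h.add])
  set H := coneExtension (fun x => ‖x‖) k
  set H' := coneExtension s k'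
  -- `H` carries the norm to the level `s`.
  have himage : H '' closedBall 0 1 = {z | s z ≤ 1} := by
    rw [image_eq_preimage_of_inverse hl hr]
    ext z
    rw [mem_preimage, mem_closedBall_zero_iff, level_coneExtension h.level_smul_of_pos
      (fun _ => h.level_pos) h.level_zero norm_zero hnorm hknorm]
    rfl
  obtain ⟨σ, hσ, hint⟩ := setIntegral_form_comp_biLipschitz h.lipschitz_prodMk hD hD' hl hr
  have hω : ω = σ • ω₀ := by
    rw [← sub_eq_zero, ← Module.forall_dual_apply_eq_zero_iff ℝ]
    intro l
    have h1 := hf l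
    -- The disk `f` may be replaced by the cone reparametrized by `H`, which has the same boundary
    -- values.
    have h2 := setIntegral_closedBall_form_congr (l.compAlternatingMap (exteriorPower.ιMulti ℝ n))
      hC (h.lipschitz_prodMk.comp hD).lipschitzOnWith fun x hx => by
        have hx1 : ‖x‖ = 1 := mem_sphere_zero_iff_norm.1 hx
        have hHx : H x = k x := coneExtension_of_eq_one (ν := fun x => ‖x‖) k hx1
        rw [Function.comp_apply, hHx]
        exact (hk x hx).2
    rw [hint _ _ measurableSet_closedBall, himage] at h2
    rw [map_sub, map_smul, hω₀, h1, smul_eq_mul, sub_eq_zero]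
    exact h2
  rcases hσ with rfl | rfl
  · exact Or.inl (by rw [hω, one_smul])
  · exact Or.inr (hω.trans (neg_one_smul ℝ ω₀))

theorem level_le_norm (h : IsPolarSplitting p q s) (z : VSpace n) : s z ≤ ‖z‖ := by
  have := h.lipschitz_level.dist_le_mul z 0
  rw [h.level_zero, NNReal.coe_one, one_mul, dist_zero_right, dist_zero_right,
    Real.norm_of_nonneg (h.nonneg z)] at this
  exact this

/-- The disk is the truncated cone itself, parametrized by radial projection of the sphere to `s =
1`. -/
theorem exists_isEnclosedDirectedVolume [NeZero n] (h : IsPolarSplitting p q s)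
    (hK : kPlus K = {w | ∃ z, s z = 1 ∧ w = (p z, q z)}) :
    ∃ ω : ⋀[ℝ]^n (WSpace n), IsEnclosedDirectedVolume (kPlus K) ω := by
  obtain ⟨c, hc, hcs⟩ := h.lower
  set k : VSpace n → VSpace n := fun x => (s x)⁻¹ • x
  have hsx : ∀ x : VSpace n, ‖x‖ = 1 → 0 < s x ∧ c ≤ s x ∧ s x ≤ 1 := fun x hx => by
    have h1 := hcs x
    have h2 := h.level_le_norm x
    rw [hx] at h1 h2
    exact ⟨by linarith, by linarith, h2⟩
  have hks : ∀ x : VSpace n, ‖x‖ = 1 → s (k x) = 1 := fun x hx =>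
    inv_smul_mem_level h.level_smul_of_pos (fun _ => h.level_pos) (by
      rintro rfl
      simp at hx)
  have hkn : ∀ x : VSpace n, ‖x‖ = 1 → ‖k x‖ = (s x)⁻¹ := fun x hx => by
    rw [norm_smul, hx, mul_one, norm_inv, Real.norm_of_nonneg (hsx x hx).1.le]
  have hkb : ∀ x : VSpace n, ‖x‖ = 1 → ‖k x‖ ≤ 1 / c := fun x hx => by
    rw [hkn x hx, ← one_div]
    exact one_div_le_one_div_of_le hc (hsx x hx).2.1
  have hklip : LipschitzOnWith ((1 + 1 / c) / c).toNNReal k (sphere 0 1) := by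
    refine LipschitzOnWith.of_dist_le_mul fun x hx y hy => ?_
    rw [mem_sphere_zero_iff_norm] at hx hy
    have hy0 := (hsx y hy).1
    have e1 := mul_norm_inv_smul_sub_le (b := s y) (hsx x hx).1 x y
    rw [smul_smul, mul_inv_cancel₀ hy0.ne', one_smul] at e1
    have e2 : |s x - s y| ≤ ‖x - y‖ := by
      simpa [Real.dist_eq, dist_eq_norm] using h.lipschitz_level.dist_le_mul x y
    have e3 : |s x - s y| * ‖(s y)⁻¹ • y‖ ≤ ‖x - y‖ * (1 / c) :=
      mul_le_mul e2 (hkb y hy) (norm_nonneg _) (norm_nonneg _)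
    have e4 : c * ‖(s x)⁻¹ • x - (s y)⁻¹ • y‖ ≤ s x * ‖(s x)⁻¹ • x - (s y)⁻¹ • y‖ :=
      mul_le_mul_of_nonneg_right (hsx x hx).2.1 (norm_nonneg _)
    rw [Real.coe_toNNReal _ (by positivity), dist_eq_norm, dist_eq_norm, div_mul_eq_mul_div,
      le_div_iff₀ hc, mul_comm]
    linarith
  obtain ⟨D, hD⟩ := exists_lipschitzWith_coneExtension_norm hklip (by positivity) hkb
  set H := coneExtension (fun x => ‖x‖) k
  have hHk : ∀ x : VSpace n, ‖x‖ = 1 → H x = k x := fun x hx =>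
    coneExtension_of_eq_one (ν := fun x => ‖x‖) k hx
  set f : VSpace n → WSpace n := (fun z => (p z, q z)) ∘ H
  have hf : LipschitzWith (1 * D) f := h.lipschitz_prodMk.comp hD
  have hfill : IsDiskFilling (kPlus K) f := by
    -- In `1 / 4`, one factor `2` is lost in normalizing `k x` back to the sphere (as `1 ≤ ‖k x‖`),
    -- the other in bounding a sum by twice a maximum.
    refine ⟨⟨_, hf.lipschitzOnWith⟩, ?_, 1 / 4, by norm_num, ?_⟩
    · rw [hK]
      ext w
      constructor
      · rintro ⟨x, hx, rfl⟩
        rw [mem_sphere_zero_iff_norm] at hx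
        exact ⟨k x, hks x hx, by simp only [f, Function.comp_apply, hHk x hx]⟩
      · rintro ⟨z, hz, rfl⟩
        have hz0 : z ≠ 0 := by
          rintro rfl
          rw [h.level_zero] at hz
          exact zero_ne_one hz
        have hzn : 0 < ‖z‖ := norm_pos_iff.2 hz0
        have hx : ‖‖z‖⁻¹ • z‖ = 1 := by
          rw [norm_smul, norm_inv, norm_norm, inv_mul_cancel₀ hzn.ne']
        refine ⟨‖z‖⁻¹ • z, mem_sphere_zero_iff_norm.2 hx, ?_⟩
        have : k (‖z‖⁻¹ • z) = z := by
          simp only [k]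
          rw [h.level_smul_of_pos _ (inv_pos.2 hzn), hz, mul_one, inv_inv, smul_smul,
            mul_inv_cancel₀ hzn.ne', one_smul]
        simp only [f, Function.comp_apply, hHk _ hx, this]
    · intro x hx y hy
      rw [mem_sphere_zero_iff_norm] at hx hy
      have hkx : ∀ x : VSpace n, ‖x‖ = 1 → 0 < ‖k x‖ ∧ 1 ≤ ‖k x‖ ∧ ‖k x‖⁻¹ • k x = x := by
        intro x hx
        obtain ⟨h1, -, h3⟩ := hsx x hx
        rw [hkn x hx, inv_inv]
        exact ⟨inv_pos.2 h1, (one_le_inv₀ h1).2 h3, by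
          simp only [k]
          rw [smul_smul, mul_inv_cancel₀ h1.ne', one_smul]⟩
      obtain ⟨hx0, hx1, hx2⟩ := hkx x hx
      obtain ⟨hy0, hy1, hy2⟩ := hkx y hy
      have e1 := mul_norm_inv_smul_sub_le (b := ‖k y‖) hx0 (k x) (k y)
      rw [hx2, hy2, hy, mul_one] at e1
      have e2 : ‖k y‖ • y = k y := by
        conv_lhs => rw [← hy2, smul_smul]
        rw [hy2, mul_inv_cancel₀ hy0.ne', one_smul]
      rw [e2] at e1
      have e3 := abs_norm_sub_norm_le (k x) (k y)
      have e4 : ‖x - y‖ ≤ ‖k x‖ * ‖x - y‖ := le_mul_of_one_le_left (norm_nonneg _) hx1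
      have e5 : ‖k x - k y‖ ≤ ‖p (k x) - p (k y)‖ + ‖q (k x) - q (k y)‖ := by
        rw [h.sub_eq (k x) (k y)]
        exact norm_add_le _ _
      have e6 : dist (f x) (f y) =
          max ‖p (k x) - p (k y)‖ ‖q (k x) - q (k y)‖ := by
        simp only [f, Function.comp_apply, hHk x hx, hHk y hy]
        rw [Prod.dist_eq, dist_eq_norm, dist_eq_norm]
      have e7 := le_max_left ‖p (k x) - p (k y)‖ ‖q (k x) - q (k y)‖
      have e8 := le_max_right ‖p (k x) - p (k y)‖ ‖q (k x) - q (k y)‖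
      rw [e6, dist_eq_norm]
      linarith
  obtain ⟨ω, hω⟩ := exists_weak_integral (μ := volume.restrict (closedBall (0 : VSpace n) 1))
    (fun x => exteriorPower.ιMulti ℝ n fun i => fderiv ℝ f x (EuclideanSpace.single i 1))
    fun l => hf.integrableOn_comp_fderiv volume
      (l.compAlternatingMap (exteriorPower.ιMulti ℝ n)).continuous_apply_comp
      (isCompact_closedBall _ _).measure_ne_top
  exact ⟨ω, f, hfill, hω⟩

end IsPolarSplitting

theorem energy_neg {k : ℕ} (ω : ⋀[ℝ]^k (WSpace n)) : energy (-ω) = energy ω := by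
  simp only [energy, exteriorForm, map_neg, LinearMap.neg_apply, neg_neg]

theorem directedVolume_kHeart_kDiamond [NeZero n] (hK : IsSymmetricConvexBody K) :
    (∃ ω : ⋀[ℝ]^n (WSpace n), IsEnclosedDirectedVolume (kPlus K) ω) ∧
      (∀ ω ω' : ⋀[ℝ]^n (WSpace n), IsEnclosedDirectedVolume (kPlus K) ω →
        IsEnclosedDirectedVolume (kPlus K) ω' → ω' = ω ∨ ω' = -ω) ∧
      (∀ ω : ⋀[ℝ]^n (WSpace n), IsEnclosedDirectedVolume (kPlus K) ω →
        ((2 * n).choose n : ℝ) * volume.real (kHeart K) = energy ω) ∧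
      kHeart K ⊆ kDiamond K ∧
      (IsEllipsoid K → kHeart K = kDiamond K) := by
  obtain ⟨p, q, s, h, hplus⟩ := hK.exists_isPolarSplitting
  obtain ⟨ω₀, hω₀⟩ := h.exists_coneVolume
  refine ⟨h.exists_isEnclosedDirectedVolume hplus, fun ω ω' hω hω' => ?_, fun ω hω => ?_,
    h.kHeart_subset_kDiamond hplus, fun hE => hE.kHeart_eq_kDiamond h hplus⟩
  · rcases h.eq_or_eq_neg_of_isEnclosedDirectedVolume hplus hω₀ hω with rfl | rfl <;>
      rcases h.eq_or_eq_neg_of_isEnclosedDirectedVolume hplus hω₀ hω' with rfl | rfl <;> simp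
  · obtain ⟨N, hcont, hN, hhom, ⟨c, hc, hcN⟩, -, hheart⟩ := h.exists_joinNorm_kHeart hplus
    rw [hheart, h.choose_mul_volume_eq_energy hcont hN hhom hc hcN hω₀]
    rcases h.eq_or_eq_neg_of_isEnclosedDirectedVolume hplus hω₀ hω with rfl | rfl
    · rfl
    · rw [energy_neg]

theorem isBounded_kDiamond (hK : IsSymmetricConvexBody K) :
    Bornology.IsBounded (kDiamond K) := by
  rw [kDiamond, isBounded_convexHull]
  obtain ⟨p, q, s, h, hplus⟩ := hK.exists_isPolarSplitting
  obtain ⟨c, hc, hcs⟩ := h.lower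
  have hb : ∀ z, s z = 1 → ‖((p z, q z) : WSpace n)‖ ≤ 1 / c := fun z hz => by
    have h1 := h.lipschitz_prodMk.dist_le_mul z 0
    have h2 := hcs z
    simp only [h.fst_zero, h.snd_zero, NNReal.coe_one, one_mul, dist_zero_right] at h1
    rw [Prod.mk_zero_zero, dist_zero_right] at h1
    rw [le_div_iff₀ hc]
    rw [hz] at h2
    nlinarith
  refine isBounded_iff_forall_norm_le.2 ⟨1 / c, ?_⟩
  rintro w (hw | hw)
  · rw [hplus] at hw
    obtain ⟨z, hz, rfl⟩ := hw
    exact hb z hz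
  · rw [mem_kMinus_iff, hplus] at hw
    obtain ⟨z, hz, e⟩ := hw
    have h1 := hb z hz
    rw [← e] at h1
    simpa [Prod.norm_def] using h1

theorem bottleneckConjectureOn_of_energyConjectureOn [NeZero n] {𝒞 : Set (Set (VSpace n))}
    (hQ : EnergyConjectureOn 𝒞) : BottleneckConjectureOn 𝒞 := by
  intro E K hE hK h𝒞
  obtain ⟨⟨ωE, hωE⟩, -, hvE, -, heqE⟩ := directedVolume_kHeart_kDiamond hE.isSymmetricConvexBody
  obtain ⟨⟨ωK, hωK⟩, -, hvK, hsub, heqK⟩ := directedVolume_kHeart_kDiamond hK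
  obtain ⟨hle, hiff⟩ := hQ E K hE hK h𝒞 ωE ωK hωE hωK
  have hv1 := hvE ωE hωE
  have hv2 := hvK ωK hωK
  rw [heqE hE] at hv1
  have hch : (0 : ℝ) < (2 * n).choose n := by
    exact_mod_cast Nat.choose_pos (by omega)
  have hmono : volume.real (kHeart K) ≤ volume.real (kDiamond K) :=
    measureReal_mono hsub (isBounded_kDiamond hK).measure_lt_top.ne
  have hEK : volume.real (kDiamond E) ≤ volume.real (kHeart K) := by
    refine le_of_mul_le_mul_left ?_ hch
    rw [hv1, hv2]
    exact hle
  refine ⟨hEK.trans hmono, fun heq => ?_, fun hell => ?_⟩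
  -- Equality of the outer volumes collapses the chain `Vol E^◇ ≤ Vol K^♥ ≤ Vol K^◇`, so the
  -- energies are equal.
  · rw [← hiff, ← hv1, ← hv2]
    congr 1
    exact le_antisymm (hmono.trans heq.le) hEK
  · rw [← heqK hell]
    refine mul_left_cancel₀ hch.ne' ?_
    rw [hv1, hv2]
    exact hiff.2 hell

end DirectedVolume

theorem mainTheorem4 (n : ℕ) (hn : 0 < n) :
    (∀ K : Set (VSpace n), IsSymmetricConvexBody K →
      (∃ ω : ⋀[ℝ]^n (WSpace n), IsEnclosedDirectedVolume (kPlus K) ω) ∧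
      (∀ ω ω' : ⋀[ℝ]^n (WSpace n), IsEnclosedDirectedVolume (kPlus K) ω →
        IsEnclosedDirectedVolume (kPlus K) ω' → ω' = ω ∨ ω' = -ω) ∧
      (∀ ω : ⋀[ℝ]^n (WSpace n), IsEnclosedDirectedVolume (kPlus K) ω →
        ((2 * n).choose n : ℝ) * volume.real (kHeart K) = energy ω) ∧
      kHeart K ⊆ kDiamond K ∧
      (IsEllipsoid K → kHeart K = kDiamond K)) ∧
    (EnergyConjecture n → BottleneckConjecture n) ∧
    (∀ 𝒞 : Set (Set (VSpace n)), EnergyConjectureOn 𝒞 → BottleneckConjectureOn 𝒞) := by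
  have : NeZero n := ⟨hn.ne'⟩
  exact ⟨fun K hK => directedVolume_kHeart_kDiamond hK,
    bottleneckConjectureOn_of_energyConjectureOn,
    fun 𝒞 => bottleneckConjectureOn_of_energyConjectureOn⟩
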